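/- All graphs are finite, simple and undirected. Two vertices $u,v$ of a graph $G$ are \emph{twins} if $N_G(u)\setminus\{v\}=N_G(v)\setminus\{u\}$; this is an equivalence relation on $V(G)$, its classes are the \emph{twin classes} of $G$, and the \emph{neighborhood diversity} $\mathrm{nd}(G)$ is the number of twin classes of $G$. \textsc{Maximum Common Induced Subgraph} is the following decision problem: given graphs $G_1,G_2$ and an integer $h\ge 0$, decide whether there is a graph $H$ with at least $h$ vertices such that both $G_1$ and $G_2$ contain an induced subgraph isomorphic to $H$. \textbf{Theorem.} \textsc{Maximum Common Induced Subgraph} is fixed-parameter tractable parameterized by $\mathrm{nd}(G_1)+\mathrm{nd}(G_2)$. That is, there are an algorithm, a computable function $f\colon\mathbb{N}\to\mathbb{N}$ and a constant $c$ such that the algorithm decides every instance $\langle G_1,G_2,h\rangle$ correctly in at most $f(\mathrm{nd}(G_1)+\mathrm{nd}(G_2))\cdot N^{c}$ steps, where $N$ is the size of the instance (the graphs given by adjacency matrices, $h$ in binary) and steps are those of a random access machine with addition and subtraction at unit cost. -/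

import Mathlib

/-! ### Twins and neighborhood diversity -/

namespace SimpleGraph

variable {V : Type*}

/-- Two vertices are twins if they have the same neighborhood when the adjacency between them is
ignored. -/
def Twins (G : SimpleGraph V) (u v : V) : Prop :=
  G.neighborSet u \ {v} = G.neighborSet v \ {u}

theorem twins_iff (G : SimpleGraph V) (u v : V) :
    G.Twins u v ↔ ∀ w, w ≠ u → w ≠ v → (G.Adj u w ↔ G.Adj v w) := by
  unfold Twins
  rw [Set.ext_iff]
  constructor
  · intro h w hu hv
    simpa [hu, hv] using h w
  · intro h w
    by_cases hu : w = u
    · subst hu; simp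
    · by_cases hv : w = v
      · subst hv; simp
      · simpa [hu, hv] using h w hu hv

theorem twins_equivalence (G : SimpleGraph V) : Equivalence G.Twins where
  refl _ := rfl
  symm h := Eq.symm h
  trans := by
    intro a b c hab hbc
    rw [twins_iff] at *
    intro w ha hc
    by_cases hb : w = b
    · subst hb
      by_cases hac : a = c
      · subst hac; rfl
      · have h1 := hab c (Ne.symm hac) (Ne.symm hc)
        have h2 := hbc a (Ne.symm ha) hac
        rw [G.adj_comm a w, h2, G.adj_comm c a, h1, G.adj_comm w c]
    · exact (hab w ha hb).trans (hbc w hb hc)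

/-- The twin classes of a graph are the classes of this equivalence relation. -/
def twinSetoid (G : SimpleGraph V) : Setoid V := ⟨G.Twins, G.twins_equivalence⟩

/-- The neighborhood diversity: the number of twin classes. -/
noncomputable def nd (G : SimpleGraph V) : ℕ := Nat.card (Quotient G.twinSetoid)

end SimpleGraph

/-! ### Random access machines

The additive RAM with uniform cost: registers hold natural numbers, are addressed directly or
indirectly, and are all `0` at the start; the input is a finite list of natural numbers with
read-only random access. Every instruction costs one step. There is no multiplication, so that `t`
steps can lengthen the binary representation of numbers by at most `O(t)` bits, and running times
agree with those of Turing machines up to a polynomial. -/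

namespace RAM

/-- The instructions; `R` is the register file, `x` the input. -/
inductive Instr where
  /-- `R[d] := c` -/
  | const (d c : ℕ)
  /-- `R[d] := R[a]` -/
  | copy (d a : ℕ)
  /-- `R[d] := R[a] + R[b]` -/
  | add (d a b : ℕ)
  /-- `R[d] := max (R[a] - R[b]) 0` -/
  | sub (d a b : ℕ)
  /-- `R[d] := R[R[a]]` -/
  | load (d a : ℕ)
  /-- `R[R[d]] := R[a]` -/
  | store (d a : ℕ)
  /-- `R[d] := x[R[a]]`, which is `0` beyond the end of the input -/
  | read (d a : ℕ)
  /-- `R[d] :=` the number of entries of the input -/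
  | len (d : ℕ)
  /-- go to instruction number `l` -/
  | jump (l : ℕ)
  /-- go to instruction number `l` if `R[a] = 0` -/
  | jz (a l : ℕ)

/-- A program is a finite list of instructions, numbered from `0`. -/
abbrev Program := List Instr

/-- A configuration: the program counter and the contents of the registers. -/
structure Cfg where
  pc : ℕ
  reg : ℕ → ℕ

/-- Write `v` into register `d` and go on to the next instruction. -/
def Cfg.write (s : Cfg) (d v : ℕ) : Cfg := ⟨s.pc + 1, Function.update s.reg d v⟩

/-- The effect of one instruction on a configuration, on input `x`. -/
def Instr.exec (x : List ℕ) (s : Cfg) : Instr → Cfg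
  | const d c => s.write d c
  | copy d a => s.write d (s.reg a)
  | add d a b => s.write d (s.reg a + s.reg b)
  | sub d a b => s.write d (s.reg a - s.reg b)
  | load d a => s.write d (s.reg (s.reg a))
  | store d a => s.write (s.reg d) (s.reg a)
  | read d a => s.write d (x.getD (s.reg a) 0)
  | len d => s.write d x.length
  | jump l => ⟨l, s.reg⟩
  | jz a l => ⟨if s.reg a = 0 then l else s.pc + 1, s.reg⟩

/-- One step of the program `P` on input `x`. Configurations whose program counter points outside
the program are halted. -/
def step (P : Program) (x : List ℕ) (s : Cfg) : Cfg :=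
  match P[s.pc]? with
  | some i => i.exec x s
  | none => s

/-- The configuration after `t` steps of the program `P` on input `x`. -/
def run (P : Program) (x : List ℕ) (t : ℕ) : Cfg := (step P x)^[t] ⟨0, fun _ => 0⟩

/-- On input `x` the program `P` halts after at most `T` steps, with output `b` in register `0`. -/
def OutputsWithin (P : Program) (x : List ℕ) (b T : ℕ) : Prop :=
  ∃ t ≤ T, P.length ≤ (run P x t).pc ∧ (run P x t).reg 0 = b

/-- The size of an input: the total binary length of its entries, plus one for each entry. -/
def inputSize (x : List ℕ) : ℕ := (x.map fun a => Nat.size a + 1).sum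

end RAM

/-- The decision problem with instances `I`, encoded by `enc`, and yes-instances `Yes` is
fixed-parameter tractable parameterized by `κ`: one algorithm decides every instance `i` in time
`f (κ i) * |i| ^ c`, for a computable function `f` and a constant `c`. -/
def IsFPT {I : Type} (enc : I → List ℕ) (Yes : I → Prop) (κ : I → ℕ) : Prop :=
  ∃ (P : RAM.Program) (f : ℕ → ℕ) (c : ℕ), Computable f ∧ ∀ i : I,
    (Yes i → RAM.OutputsWithin P (enc i) 1 (f (κ i) * RAM.inputSize (enc i) ^ c)) ∧
    (¬ Yes i → RAM.OutputsWithin P (enc i) 0 (f (κ i) * RAM.inputSize (enc i) ^ c))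

/-! ### Maximum Common Induced Subgraph -/

/-- An instance: two finite simple graphs and a number `h`. -/
structure MCISInstance where
  n₁ : ℕ
  n₂ : ℕ
  G₁ : SimpleGraph (Fin n₁)
  G₂ : SimpleGraph (Fin n₂)
  h : ℕ

open Classical in
/-- The adjacency matrix, row by row: entry number `k = n * i + j` belongs to the vertices
`i = k / n` and `j = k % n`. -/
noncomputable def adjBits {n : ℕ} (G : SimpleGraph (Fin n)) : List ℕ :=
  List.ofFn fun k : Fin (n * n) => if G.Adj k.divNat k.modNat then 1 else 0

namespace MCISInstance

/-- The encoding of an instance: the numbers of vertices, `h`, and the adjacency matrices. -/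
noncomputable def encode (i : MCISInstance) : List ℕ :=
  [i.n₁, i.n₂, i.h] ++ adjBits i.G₁ ++ adjBits i.G₂

/-- There is a graph with at least `h` vertices that is isomorphic to an induced subgraph of `G₁`
and to an induced subgraph of `G₂`. -/
def IsYes (i : MCISInstance) : Prop :=
  ∃ (m : ℕ) (H : SimpleGraph (Fin m)),
    i.h ≤ m ∧ H.IsIndContained i.G₁ ∧ H.IsIndContained i.G₂

end MCISInstance

/-! ### A language of bounded loops and its compilation to random access machines -/

namespace LoopLang

open RAM

/-! A common induced subgraph is a list of vertex pairs (u, v) that are pairwise distinct in both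
coordinates and have matching adjacencies. Adjacency of distinct vertices depends only on their twin
classes, so whether two disjoint pairs are compatible depends only on the cells they lie in, a cell
being a pair of twin classes, one of each graph (`compat_of_cls_eq`). Inside a cell either all
disjoint pairs are compatible or no two are; the latter cells are `Mixed`. Hence, once the set S of
cells that an optimal solution uses is fixed, only the number x t of pairs in each cell t matters: x
t = 1 in mixed cells, and the row and column sums of x are at most the class sizes. This is a
transportation problem on S.

It is solved by guessing an order of cells and filling each cell greedily. Some order loses nothing
(`exists_phases`). Mixed cells come first and take one pair each. After that,
`exists_zero_or_saturated` replaces a feasible real point, without loss in the total, by one in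
which some cell is 0 or equals the smaller of its row and column bounds. A cell with value 0 can be
dropped; a saturated cell is filled by the greedy phase with exactly that amount; either way S
shrinks and the residual problem stays feasible.

The exchange property is shown at a point of largest total and, among those, of largest sum of
squares. If no cell is 0 or saturated, every tight row or column has at least two cells in S.
Counting then leaves fewer independent tight equations than cells, so the point can move both ways
along a line. The total must be constant on it, but the sum of squares is strictly convex: a
contradiction.

The algorithm numbers the twin classes, K in total, and tries all K ^ (2K²) guesses, each coding K²
cells. Every guess yields a valid list, and by `exists_guess_of_valid` some guess yields one at
least as long as any given solution. The program is written in a language of bounded loops with a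
verified compiler (`Cmd.runs_compile`), and its running time is polynomial in the largest loop bound
(`exists_time_le`), which is at most N + κ + (κ + 1) ^ (2κ²), where N is the input size and κ the
parameter. -/

/-- A state: scalar variables and eight unbounded arrays. -/
@[ext] structure St where
  v : ℕ → ℕ
  a : Fin 8 → ℕ → ℕ

namespace St

def setV (s : St) (i n : ℕ) : St := ⟨Function.update s.v i n, s.a⟩

def setA (s : St) (k : Fin 8) (i n : ℕ) : St :=
  ⟨s.v, Function.update s.a k (Function.update (s.a k) i n)⟩

@[simp] theorem setV_a (s : St) (i n : ℕ) : (s.setV i n).a = s.a := rfl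

@[simp] theorem setA_v (s : St) (k : Fin 8) (i n : ℕ) : (s.setA k i n).v = s.v := rfl

@[simp] theorem setV_v_self (s : St) (i n : ℕ) : (s.setV i n).v i = n := by simp [setV]

theorem setV_v (s : St) (i n j : ℕ) : (s.setV i n).v j = if j = i then n else s.v j := by
  simp [setV, Function.update_apply]

theorem setV_v_of_ne (s : St) {i j : ℕ} (n : ℕ) (h : j ≠ i) : (s.setV i n).v j = s.v j := by
  simp [setV, h]

theorem setA_a (s : St) (k : Fin 8) (i n : ℕ) (l : Fin 8) (j : ℕ) :
    (s.setA k i n).a l j = if l = k ∧ j = i then n else s.a l j := by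
  by_cases h : l = k
  · subst h; simp [setA, Function.update_apply]
  · simp [setA, h]

theorem setA_a_of_ne (s : St) {k l : Fin 8} (i n : ℕ) (h : l ≠ k) :
    (s.setA k i n).a l = s.a l := by
  simp [setA, h]

end St

/-- Expressions. Subtraction is truncated; `arr k e` is cell number `e` of array `k`, and `inp e`
is entry number `e` of the input. -/
inductive Expr where
  | lit (n : ℕ)
  | var (i : ℕ)
  | add (e f : Expr)
  | sub (e f : Expr)
  | arr (k : Fin 8) (e : Expr)
  | inp (e : Expr)

namespace Expr

@[simp] def eval (x : List ℕ) (s : St) : Expr → ℕ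
  | lit n => n
  | var i => s.v i
  | add e f => e.eval x s + f.eval x s
  | sub e f => e.eval x s - f.eval x s
  | arr k e => s.a k (e.eval x s)
  | inp e => x.getD (e.eval x s) 0

/-- The number of steps that the evaluation takes. -/
def size : Expr → ℕ
  | lit _ => 1
  | var _ => 1
  | add e f => e.size + f.size + 1
  | sub e f => e.size + f.size + 1
  | arr _ e => e.size + 7
  | inp e => e.size + 1

/-- An expression that is `0` if and only if the two expressions agree. -/
def neq (e f : Expr) : Expr := (e.sub f).add (f.sub e)

theorem eval_neq_eq_zero (x : List ℕ) (s : St) (e f : Expr) :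
    (e.neq f).eval x s = 0 ↔ e.eval x s = f.eval x s := by
  simp only [neq, eval]; omega

end Expr

/-- Commands. `ite e c c'` runs `c` if `e` is `0` and `c'` otherwise; `loop i z c` runs `c` with
`0, 1, 2, …` in variable `i`, as often as the initial value of variable `z` says. -/
inductive Cmd where
  | skip
  | set (i : ℕ) (e : Expr)
  | put (k : Fin 8) (e f : Expr)
  | seq (c c' : Cmd)
  | ite (e : Expr) (c c' : Cmd)
  | loop (i z : ℕ) (c : Cmd)

namespace Cmd

def eval (x : List ℕ) : Cmd → St → St
  | skip, s => s
  | set i e, s => s.setV i (e.eval x s)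
  | put k e f, s => s.setA k (e.eval x s) (f.eval x s)
  | seq c c', s => c'.eval x (c.eval x s)
  | ite e c c', s => if e.eval x s = 0 then c.eval x s else c'.eval x s
  | loop i z c, s => (List.range (s.v z)).foldl (fun s j => c.eval x (s.setV i j)) s

/-- The number of steps that a command takes. -/
def cost (x : List ℕ) : Cmd → St → ℕ
  | skip, _ => 0
  | set _ e, _ => e.size + 1
  | put _ e f, _ => e.size + f.size + 7
  | seq c c', s => c.cost x s + c'.cost x (c.eval x s)
  | ite e c c', s => e.size + 1 + if e.eval x s = 0 then c.cost x s else c'.cost x s + 1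
  | loop i z c, s => 4 + ∑ j ∈ Finset.range (s.v z),
      (6 + c.cost x (((List.range j).foldl (fun s j => c.eval x (s.setV i j)) s).setV i j))

end Cmd

/-! #### The compiler -/

/-- The register of a temporary value. -/
abbrev tmp (d : ℕ) : ℕ := 16 * d + 1

/-- The register of a variable. -/
abbrev vreg (i : ℕ) : ℕ := 16 * i

/-- Replaces the index in temporary `d` by the register of that cell of array `k`. -/
def addrCode (k : Fin 8) (d : ℕ) : List Instr :=
  [.add (tmp d) (tmp d) (tmp d), .add (tmp d) (tmp d) (tmp d), .add (tmp d) (tmp d) (tmp d),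
    .add (tmp d) (tmp d) (tmp d), .const (tmp (d + 1)) (2 + k),
    .add (tmp d) (tmp d) (tmp (d + 1))]

/-- Code that puts the value of an expression into temporary `d`. -/
def Expr.compile : Expr → ℕ → List Instr
  | lit n, d => [.const (tmp d) n]
  | var i, d => [.copy (tmp d) (vreg i)]
  | add e f, d => e.compile d ++ (f.compile (d + 1) ++ [.add (tmp d) (tmp d) (tmp (d + 1))])
  | sub e f, d => e.compile d ++ (f.compile (d + 1) ++ [.sub (tmp d) (tmp d) (tmp (d + 1))])
  | arr k e, d => e.compile d ++ (addrCode k d ++ [.load (tmp d) (tmp d)])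
  | inp e, d => e.compile d ++ [.read (tmp d) (tmp d)]

/-- The number of instructions of a compiled command. -/
def Cmd.len : Cmd → ℕ
  | skip => 0
  | set _ e => e.size + 1
  | put _ e f => e.size + (6 + (f.size + 1))
  | seq c c' => c.len + c'.len
  | ite e c c' => e.size + (1 + (c'.len + (1 + c.len)))
  | loop _ _ c => 5 + (c.len + 3)

/-- The code of a command, for position `o` of a program; temporaries below `d` are kept. -/
def Cmd.compile : Cmd → ℕ → ℕ → List Instr
  | skip, _, _ => []
  | set i e, d, _ => e.compile d ++ [.copy (vreg i) (tmp d)]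
  | put k e f, d, _ =>
      e.compile d ++ (addrCode k d ++ (f.compile (d + 1) ++ [.store (tmp d) (tmp (d + 1))]))
  | seq c c', d, o => c.compile d o ++ c'.compile d (o + c.len)
  | ite e c c', d, o =>
      e.compile d ++ ([.jz (tmp d) (o + e.size + 1 + c'.len + 1)] ++
        (c'.compile d (o + e.size + 1) ++ ([.jump (o + e.size + 1 + c'.len + 1 + c.len)] ++
          c.compile d (o + e.size + 1 + c'.len + 1))))
  | loop i z c, d, o =>
      [.copy (tmp d) (vreg z), .const (tmp (d + 1)) 0,
        .sub (tmp (d + 2)) (tmp d) (tmp (d + 1)), .jz (tmp (d + 2)) (o + (5 + (c.len + 3))),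
        .copy (vreg i) (tmp (d + 1))] ++ (c.compile (d + 2) (o + 5) ++
        [.const (tmp (d + 2)) 1, .add (tmp (d + 1)) (tmp (d + 1)) (tmp (d + 2)), .jump (o + 2)])

theorem Expr.length_compile (e : Expr) (d : ℕ) : (e.compile d).length = e.size := by
  induction e generalizing d with
  | lit | var => rfl
  | add e f he hf | sub e f he hf => simp [compile, size, he, hf]; omega
  | arr k e he => simp [compile, size, he, addrCode]
  | inp e he => simp [compile, size, he]

theorem Cmd.length_compile (c : Cmd) (d o : ℕ) : (c.compile d o).length = c.len := by
  induction c generalizing d o with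
  | skip => rfl
  | set => simp [compile, len, Expr.length_compile]
  | put => simp [compile, len, Expr.length_compile, addrCode]; omega
  | seq c c' h h' => simp [compile, len, h, h']
  | ite e c c' h h' => simp [compile, len, h, h', Expr.length_compile]; omega
  | loop i z c h => simp [compile, len, h]; omega

/-! ### Correctness of the compiler -/

/-- The code `l` stands at position `o` of the program `P`. -/
def CodeAt (P : Program) (o : ℕ) (l : List Instr) : Prop :=
  ∀ k i, l[k]? = some i → P[o + k]? = some i

theorem codeAt_append {P : Program} {o : ℕ} {l l' : List Instr} :
    CodeAt P o (l ++ l') ↔ CodeAt P o l ∧ CodeAt P (o + l.length) l' := by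
  constructor
  · intro h
    refine ⟨fun k i hk => h k i ?_, fun k i hk => ?_⟩
    · have := (List.getElem?_eq_some_iff.1 hk).1
      rw [List.getElem?_append_left this, hk]
    · rw [add_assoc]
      apply h
      rw [List.getElem?_append_right (by omega)]
      simpa using hk
  · rintro ⟨h, h'⟩ k i hk
    by_cases hkl : k < l.length
    · rw [List.getElem?_append_left hkl] at hk
      exact h k i hk
    · rw [List.getElem?_append_right (by omega)] at hk
      have := h' _ i hk
      rwa [show o + l.length + (k - l.length) = o + k by omega] at this

theorem codeAt_cons {P : Program} {o : ℕ} {i : Instr} {l : List Instr} :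
    CodeAt P o (i :: l) ↔ P[o]? = some i ∧ CodeAt P (o + 1) l := by
  rw [← List.singleton_append, codeAt_append]
  refine and_congr ⟨fun h => h 0 i rfl, fun h k j hk => ?_⟩ Iff.rfl
  obtain ⟨hk1, hk2⟩ := List.getElem?_eq_some_iff.1 hk
  simp only [List.length_singleton, Nat.lt_one_iff] at hk1
  subst hk1
  simpa [← hk2] using h

/-- In `t` steps the machine comes from one configuration to another. -/
def Runs (P : Program) (x : List ℕ) (t pc : ℕ) (r : ℕ → ℕ) (pc' : ℕ) (r' : ℕ → ℕ) : Prop :=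
  (step P x)^[t] ⟨pc, r⟩ = ⟨pc', r'⟩

theorem Runs.refl (P : Program) (x : List ℕ) (pc : ℕ) (r : ℕ → ℕ) : Runs P x 0 pc r pc r := rfl

theorem Runs.trans {P : Program} {x : List ℕ} {t t' p p' p'' : ℕ} {r r' r'' : ℕ → ℕ}
    (h : Runs P x t p r p' r') (h' : Runs P x t' p' r' p'' r'') :
    Runs P x (t + t') p r p'' r'' := by
  unfold Runs at *
  rw [add_comm, Function.iterate_add_apply, h, h']

theorem Runs.instr {P : Program} {x : List ℕ} {p : ℕ} {i : Instr} (h : P[p]? = some i)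
    (r : ℕ → ℕ) : Runs P x 1 p r (i.exec x ⟨p, r⟩).pc (i.exec x ⟨p, r⟩).reg := by
  simp [Runs, step, h]

theorem Runs.cast {P : Program} {x : List ℕ} {t t' p p' q : ℕ} {r r' : ℕ → ℕ}
    (h : Runs P x t p r p' r') (ht : t = t') (hp : p' = q) : Runs P x t' p r q r' := by
  subst ht hp; exact h

/-- The registers `r` represent the state `s`. -/
def Rep (r : ℕ → ℕ) (s : St) : Prop :=
  (∀ i, r (vreg i) = s.v i) ∧ ∀ (k : Fin 8) i, r (16 * i + (2 + k)) = s.a k i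

/-- Registers are separated by their residue modulo 16: 0 for variables, 1 for temporaries, 2 + k
for array k. Hence temporaries never collide with the represented state. -/
theorem Rep.update_tmp {r : ℕ → ℕ} {s : St} (h : Rep r s) (d n : ℕ) :
    Rep (Function.update r (tmp d) n) s := by
  refine ⟨fun i => ?_, fun k i => ?_⟩
  · rw [Function.update_of_ne (by simp only [tmp, vreg]; omega), h.1]
  · rw [Function.update_of_ne (by simp only [tmp]; omega), h.2]

theorem Rep.update_vreg {r : ℕ → ℕ} {s : St} (h : Rep r s) (i n : ℕ) :
    Rep (Function.update r (vreg i) n) (s.setV i n) := by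
  refine ⟨fun j => ?_, fun k j => ?_⟩
  · by_cases hj : j = i
    · subst hj; simp
    · rw [Function.update_of_ne (by simp only [vreg]; omega), h.1, St.setV_v_of_ne _ _ hj]
  · rw [Function.update_of_ne (by simp only [vreg]; omega), h.2, St.setV_a]

theorem Rep.update_cell {r : ℕ → ℕ} {s : St} (h : Rep r s) (k : Fin 8) (i n : ℕ) :
    Rep (Function.update r (16 * i + (2 + k)) n) (s.setA k i n) := by
  refine ⟨fun j => ?_, fun l j => ?_⟩
  · rw [Function.update_of_ne (by simp only [vreg]; omega), h.1, St.setA_v]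
  · rw [St.setA_a]
    by_cases hj : l = k ∧ j = i
    · rw [if_pos hj, hj.1, hj.2, Function.update_self]
    · rw [if_neg hj, Function.update_of_ne, h.2]
      intro he
      exact hj ⟨Fin.ext (by omega), by omega⟩

/-- The temporaries below `d` agree. -/
def Keep (d : ℕ) (r r' : ℕ → ℕ) : Prop := ∀ j < d, r' (tmp j) = r (tmp j)

theorem Keep.refl (d : ℕ) (r : ℕ → ℕ) : Keep d r r := fun _ _ => rfl

theorem Keep.trans {d : ℕ} {r r' r'' : ℕ → ℕ} (h : Keep d r r') (h' : Keep d r' r'') :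
    Keep d r r'' := fun j hj => (h' j hj).trans (h j hj)

theorem Keep.mono {d d' : ℕ} {r r' : ℕ → ℕ} (h : Keep d r r') (hd : d' ≤ d) : Keep d' r r' :=
  fun j hj => h j (hj.trans_le hd)

theorem Keep.update_tmp {d d' : ℕ} {r r' : ℕ → ℕ} (h : Keep d r r') (hd : d ≤ d') (n : ℕ) :
    Keep d r (Function.update r' (tmp d') n) := by
  intro j hj
  rw [Function.update_of_ne (by simp only [tmp]; omega), h j hj]

theorem Keep.update_vreg {d : ℕ} {r r' : ℕ → ℕ} (h : Keep d r r') (i n : ℕ) :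
    Keep d r (Function.update r' (vreg i) n) := by
  intro j hj
  rw [Function.update_of_ne (by simp only [tmp, vreg]; omega), h j hj]

theorem Keep.update_cell {d : ℕ} {r r' : ℕ → ℕ} (h : Keep d r r') (k : Fin 8) (i n : ℕ) :
    Keep d r (Function.update r' (16 * i + (2 + k)) n) := by
  intro j hj
  rw [Function.update_of_ne (by simp only [tmp]; omega), h j hj]

/-- Four doublings multiply the index by 16, as the machine has no multiplication; adding 2 + k
selects the residue of the array. -/
theorem runs_addrCode {P : Program} {x : List ℕ} {o d : ℕ} {k : Fin 8} {r : ℕ → ℕ} {s : St}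
    (hc : CodeAt P o (addrCode k d)) (hr : Rep r s) :
    ∃ r', Runs P x 6 o r (o + 6) r' ∧ Rep r' s ∧ Keep d r r' ∧
      r' (tmp d) = 16 * r (tmp d) + (2 + k) := by
  simp only [addrCode, codeAt_cons] at hc
  obtain ⟨h1, h2, h3, h4, h5, h6, -⟩ := hc
  refine ⟨_, ((((((Runs.instr h1 r).trans (Runs.instr h2 _)).trans (Runs.instr h3 _)).trans
    (Runs.instr h4 _)).trans (Runs.instr h5 _)).trans (Runs.instr h6 _)).cast rfl rfl,
    ?_, ?_, ?_⟩
  · exact (((((hr.update_tmp _ _).update_tmp _ _).update_tmp _ _).update_tmp _ _).update_tmp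
      _ _).update_tmp _ _
  · exact ((((((Keep.refl d r).update_tmp le_rfl _).update_tmp le_rfl _).update_tmp le_rfl
      _).update_tmp le_rfl _).update_tmp (Nat.le_succ d) _).update_tmp le_rfl _
  · have : tmp d ≠ tmp (d + 1) := by simp [tmp]
    simp only [Instr.exec, Cfg.write, Function.update_self, Function.update_of_ne this]
    omega

/-- The second operand is compiled one level higher, so that `Keep` preserves the value of the first
one while the second is computed. -/
theorem Expr.runs_compile {P : Program} {x : List ℕ} (e : Expr) {o d : ℕ} {r : ℕ → ℕ} {s : St}
    (hc : CodeAt P o (e.compile d)) (hr : Rep r s) :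
    ∃ r', Runs P x e.size o r (o + e.size) r' ∧ Rep r' s ∧ Keep d r r' ∧
      r' (tmp d) = e.eval x s := by
  induction e generalizing o d r with
  | lit n =>
    simp only [compile, codeAt_cons] at hc
    exact ⟨_, Runs.instr hc.1 r, hr.update_tmp _ _, (Keep.refl d r).update_tmp le_rfl _,
      by simp [Instr.exec, Cfg.write]⟩
  | var i =>
    simp only [compile, codeAt_cons] at hc
    exact ⟨_, Runs.instr hc.1 r, hr.update_tmp _ _, (Keep.refl d r).update_tmp le_rfl _,
      by simp only [Instr.exec, Cfg.write, Function.update_self, eval, hr.1]⟩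
  | add e f he hf | sub e f he hf =>
    simp only [compile, codeAt_append, codeAt_cons, length_compile] at hc
    obtain ⟨hc1, hc2, hc3, -⟩ := hc
    obtain ⟨r1, h1, hr1, hk1, hv1⟩ := he hc1 hr
    obtain ⟨r2, h2, hr2, hk2, hv2⟩ := hf hc2 hr1
    refine ⟨_, ((h1.trans h2).trans (Runs.instr hc3 r2)).cast rfl ?_, hr2.update_tmp _ _,
      (hk1.trans (hk2.mono (Nat.le_succ d))).update_tmp le_rfl _, ?_⟩
    · simp only [Instr.exec, Cfg.write, size]; omega
    · simp only [Instr.exec, Cfg.write, Function.update_self, eval, hv2, hk2 d (Nat.lt_succ_self d),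
        hv1]
  | arr k e he =>
    simp only [compile, codeAt_append, codeAt_cons, length_compile] at hc
    obtain ⟨hc1, hc2, hc3, -⟩ := hc
    obtain ⟨r1, h1, hr1, hk1, hv1⟩ := he hc1 hr
    obtain ⟨r2, h2, hr2, hk2, hv2⟩ := runs_addrCode (x := x) hc2 hr1
    refine ⟨_, ((h1.trans h2).trans (Runs.instr hc3 r2)).cast rfl ?_, hr2.update_tmp _ _,
      (hk1.trans hk2).update_tmp le_rfl _, ?_⟩
    · simp only [Instr.exec, Cfg.write, size, addrCode, List.length_cons, List.length_nil]; omega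
    · simp only [Instr.exec, Cfg.write, Function.update_self, eval, hv2, hv1, hr2.2]
  | inp e he =>
    simp only [compile, codeAt_append, codeAt_cons, length_compile] at hc
    obtain ⟨hc1, hc2, -⟩ := hc
    obtain ⟨r1, h1, hr1, hk1, hv1⟩ := he hc1 hr
    refine ⟨_, (h1.trans (Runs.instr hc2 r1)).cast rfl ?_, hr1.update_tmp _ _,
      hk1.update_tmp le_rfl _, ?_⟩
    · simp only [Instr.exec, Cfg.write, size]; omega
    · simp only [Instr.exec, Cfg.write, Function.update_self, eval, hv1]

theorem Cmd.runs_compile {P : Program} {x : List ℕ} (c : Cmd) {o d : ℕ} {r : ℕ → ℕ} {s : St}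
    (hc : CodeAt P o (c.compile d o)) (hr : Rep r s) :
    ∃ r', Runs P x (c.cost x s) o r (o + c.len) r' ∧ Rep r' (c.eval x s) ∧ Keep d r r' := by
  induction c generalizing o d r s with
  | skip => exact ⟨r, Runs.refl _ _ _ _, hr, Keep.refl d r⟩
  | set i e =>
    simp only [compile, codeAt_append, codeAt_cons, Expr.length_compile] at hc
    obtain ⟨r1, h1, hr1, hk1, hv1⟩ := e.runs_compile (x := x) hc.1 hr
    refine ⟨_, (h1.trans (Runs.instr hc.2.1 r1)).cast rfl ?_, ?_, ?_⟩
    · simp only [Instr.exec, Cfg.write, len]; omega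
    · simp only [Instr.exec, Cfg.write, hv1]
      exact hr1.update_vreg _ _
    · exact hk1.update_vreg _ _
  | put k e f =>
    simp only [compile, codeAt_append, codeAt_cons, Expr.length_compile] at hc
    obtain ⟨hc1, hc2, hc3, hc4, -⟩ := hc
    obtain ⟨r1, h1, hr1, hk1, hv1⟩ := e.runs_compile (x := x) hc1 hr
    obtain ⟨r2, h2, hr2, hk2, hv2⟩ := runs_addrCode (x := x) hc2 hr1
    obtain ⟨r3, h3, hr3, hk3, hv3⟩ := f.runs_compile (x := x) hc3 hr2
    refine ⟨_, (((h1.trans h2).trans h3).trans (Runs.instr hc4 r3)).cast ?_ ?_, ?_, ?_⟩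
    · simp only [cost]; omega
    · simp only [Instr.exec, Cfg.write, len, addrCode, List.length_cons, List.length_nil]; omega
    · simp only [Instr.exec, Cfg.write, hv3, hk3 d (Nat.lt_succ_self d), hv2, hv1]
      exact hr3.update_cell _ _ _
    · simp only [Instr.exec, Cfg.write, hv3, hk3 d (Nat.lt_succ_self d), hv2, hv1]
      exact ((hk1.trans hk2).trans (hk3.mono (Nat.le_succ d))).update_cell _ _ _
  | seq c c' h h' =>
    simp only [compile, codeAt_append, length_compile] at hc
    obtain ⟨r1, h1, hr1, hk1⟩ := h hc.1 hr
    obtain ⟨r2, h2, hr2, hk2⟩ := h' hc.2 hr1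
    exact ⟨r2, (h1.trans h2).cast rfl (by simp only [len]; omega), hr2, hk1.trans hk2⟩
  | ite e c c' h h' =>
    simp only [compile, codeAt_append, codeAt_cons, length_compile, Expr.length_compile,
      List.length_cons, List.length_nil, zero_add] at hc
    obtain ⟨hc1, ⟨hc2, -⟩, hc3, ⟨hc4, -⟩, hc5⟩ := hc
    obtain ⟨r1, h1, hr1, hk1, hv1⟩ := e.runs_compile (x := x) hc1 hr
    have h2 := Runs.instr (x := x) hc2 r1
    simp only [Instr.exec, hv1] at h2
    by_cases he : e.eval x s = 0
    · rw [if_pos he] at h2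
      obtain ⟨r2, h3, hr2, hk2⟩ := h hc5 hr1
      refine ⟨r2, ((h1.trans h2).trans h3).cast ?_ ?_, ?_, hk1.trans hk2⟩
      · simp only [cost, if_pos he]
      · simp only [len]; omega
      · simpa only [eval, if_pos he] using hr2
    · rw [if_neg he] at h2
      obtain ⟨r2, h3, hr2, hk2⟩ := h' hc3 hr1
      refine ⟨r2, (((h1.trans h2).trans h3).trans (Runs.instr hc4 r2)).cast ?_ ?_, ?_,
        hk1.trans hk2⟩
      · simp only [cost, if_neg he]; omega
      · simp only [len, Instr.exec]; omega
      · simpa only [eval, if_neg he] using hr2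
  | loop i z c h =>
    simp only [compile, codeAt_append, codeAt_cons, length_compile,
      List.length_cons, List.length_nil, zero_add] at hc
    obtain ⟨⟨hc1, hc2, hc3, hc4, hc5, -⟩, hc6, hc7, hc8, hc9, -⟩ := hc
    have hd1 : tmp d ≠ tmp (d + 1) := by simp [tmp]
    have hd2 : tmp d ≠ tmp (d + 2) := by simp [tmp]
    have hd3 : tmp (d + 1) ≠ tmp (d + 2) := by simp [tmp]
    have hdi : ∀ j, tmp j ≠ vreg i := fun j => by simp only [tmp, vreg]; omega
    -- Temporary `d` holds the number of rounds and `d + 1` the rounds done. The body is compiled at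
    -- level `d + 2` and thus keeps both, even if it overwrites the variables `i` or `z`. The
    -- invariant is taken at the test in position `o + 2`, after two initial steps; the final
    -- failing test costs two more, which gives the 4 in `cost`.
    have key : ∀ j ≤ s.v z, ∃ r', Runs P x (2 + ∑ j ∈ Finset.range j,
        (6 + c.cost x (((List.range j).foldl (fun s j => c.eval x (s.setV i j)) s).setV i j)))
        o r (o + 2) r' ∧ Rep r' ((List.range j).foldl (fun s j => c.eval x (s.setV i j)) s) ∧
        Keep d r r' ∧ r' (tmp d) = s.v z ∧ r' (tmp (d + 1)) = j := by
      intro j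
      induction j with
      | zero =>
        intro _
        refine ⟨_, ((Runs.instr hc1 r).trans (Runs.instr hc2 _)).cast rfl rfl,
          (hr.update_tmp _ _).update_tmp _ _,
          ((Keep.refl d r).update_tmp le_rfl _).update_tmp (Nat.le_succ d) _, ?_, ?_⟩
        · simp only [Instr.exec, Cfg.write, Function.update_self, Function.update_of_ne hd1, hr.1]
        · simp only [Instr.exec, Cfg.write, Function.update_self]
      | succ j ih =>
        intro hj
        obtain ⟨r1, h1, hr1, hk1, hv1, hw1⟩ := ih (by omega)
        have h2 := Runs.instr (x := x) hc3 r1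
        simp only [Instr.exec, Cfg.write, hv1, hw1] at h2
        have h3 := Runs.instr (x := x) hc4 (Function.update r1 (tmp (d + 2)) (s.v z - j))
        simp only [Instr.exec, Function.update_self, if_neg (show ¬ s.v z - j = 0 by omega)] at h3
        have h4 := Runs.instr (x := x) hc5 (Function.update r1 (tmp (d + 2)) (s.v z - j))
        simp only [Instr.exec, Cfg.write, Function.update_of_ne hd3, hw1] at h4
        obtain ⟨r2, h5, hr2, hk2⟩ := h hc6 ((hr1.update_tmp (d + 2) (s.v z - j)).update_vreg i j)
        have hv2 := hk2 d (by omega)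
        have hw2 := hk2 (d + 1) (by omega)
        rw [Function.update_of_ne (hdi _), Function.update_of_ne hd2, hv1] at hv2
        rw [Function.update_of_ne (hdi _), Function.update_of_ne hd3, hw1] at hw2
        refine ⟨_, (((((((h1.trans h2).trans h3).trans h4).trans h5).trans
          (Runs.instr hc7 _)).trans (Runs.instr hc8 _)).trans (Runs.instr hc9 _)).cast ?_ rfl,
          ?_, ?_, ?_, ?_⟩
        · rw [Finset.sum_range_succ]; omega
        · rw [List.range_succ, List.foldl_append]
          exact (hr2.update_tmp _ _).update_tmp _ _
        · exact ((((hk1.update_tmp (by omega) _).update_vreg _ _).trans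
            (hk2.mono (by omega))).update_tmp (by omega) _).update_tmp (by omega) _
        · simp only [Instr.exec, Cfg.write, Function.update_of_ne hd1, Function.update_of_ne hd2,
            hv2]
        · simp only [Instr.exec, Cfg.write, Function.update_self, Function.update_of_ne hd3, hw2]
    obtain ⟨r1, h1, hr1, hk1, hv1, hw1⟩ := key _ le_rfl
    have h2 := Runs.instr (x := x) hc3 r1
    simp only [Instr.exec, Cfg.write, hv1, hw1] at h2
    have h3 := Runs.instr (x := x) hc4 (Function.update r1 (tmp (d + 2)) (s.v z - s.v z))
    simp only [Instr.exec, Function.update_self, if_pos (Nat.sub_self (s.v z))] at h3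
    exact ⟨_, ((h1.trans h2).trans h3).cast (by simp only [cost]; omega) (by simp only [len]),
      hr1.update_tmp _ _, hk1.update_tmp (by omega) _⟩

/-- The state in which programs start. -/
def start : St := ⟨fun _ => 0, fun _ _ => 0⟩

/-- A compiled command halts after `cost` steps with its variable `0` as output. -/
theorem Cmd.outputsWithin_compile (c : Cmd) (x : List ℕ) {T b : ℕ}
    (hT : c.cost x start ≤ T) (hb : (c.eval x start).v 0 = b) :
    OutputsWithin (c.compile 0 0) x b T := by
  obtain ⟨r, h, hr, -⟩ := c.runs_compile (P := c.compile 0 0) (x := x) (o := 0) (d := 0)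
    (r := fun _ => 0) (s := start) (fun k i h => by simpa using h)
    ⟨fun _ => rfl, fun _ _ => rfl⟩
  have h' : run (c.compile 0 0) x (c.cost x start) = ⟨0 + c.len, r⟩ := h
  refine ⟨_, hT, ?_, ?_⟩
  · rw [h', length_compile]; simp
  · rw [h', ← hb]; exact hr.1 0

/-! #### Running times and frames -/

namespace Cmd

/-- Does the command write to variable `i`? -/
def WritesV (i : ℕ) : Cmd → Bool
  | skip => false
  | set j _ => j == i
  | put _ _ _ => false
  | seq c c' => c.WritesV i || c'.WritesV i
  | ite _ c c' => c.WritesV i || c'.WritesV i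
  | loop j _ c => j == i || c.WritesV i

/-- Does the command write to array `k`? -/
def WritesA (k : Fin 8) : Cmd → Bool
  | skip => false
  | set _ _ => false
  | put l _ _ => l == k
  | seq c c' => c.WritesA k || c'.WritesA k
  | ite _ c c' => c.WritesA k || c'.WritesA k
  | loop _ _ c => c.WritesA k

/-- Frame rule: the hypothesis is a Boolean computed from the syntax, so for concrete commands it is
settled by evaluation. -/
theorem eval_v_of_not_writesV (x : List ℕ) (c : Cmd) (s : St) {i : ℕ}
    (h : c.WritesV i = false) : (c.eval x s).v i = s.v i := by
  induction c generalizing s with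
  | skip => rfl
  | set j e => exact St.setV_v_of_ne _ _ (by rintro rfl; simp [WritesV] at h)
  | put k e f => rfl
  | seq c c' hc hc' =>
    simp only [WritesV, Bool.or_eq_false_iff] at h
    rw [eval, hc' _ h.2, hc _ h.1]
  | ite e c c' hc hc' =>
    simp only [WritesV, Bool.or_eq_false_iff] at h
    simp only [eval]
    split_ifs
    · exact hc _ h.1
    · exact hc' _ h.2
  | loop j z c hc =>
    simp only [WritesV, Bool.or_eq_false_iff, beq_eq_false_iff_ne] at h
    simp only [eval]
    generalize List.range (s.v z) = l
    induction l generalizing s with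
    | nil => rfl
    | cons n l ih => rw [List.foldl_cons, ih, hc _ h.2, St.setV_v_of_ne _ _ h.1.symm]

theorem eval_a_of_not_writesA (x : List ℕ) (c : Cmd) (s : St) {k : Fin 8}
    (h : c.WritesA k = false) : (c.eval x s).a k = s.a k := by
  induction c generalizing s with
  | skip => rfl
  | set j e => rfl
  | put l e f => exact St.setA_a_of_ne _ _ _ (by rintro rfl; simp [WritesA] at h)
  | seq c c' hc hc' =>
    simp only [WritesA, Bool.or_eq_false_iff] at h
    rw [eval, hc' _ h.2, hc _ h.1]
  | ite e c c' hc hc' =>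
    simp only [WritesA, Bool.or_eq_false_iff] at h
    simp only [eval]
    split_ifs
    · exact hc _ h.1
    · exact hc' _ h.2
  | loop j z c hc =>
    simp only [WritesA] at h
    simp only [eval]
    generalize List.range (s.v z) = l
    induction l generalizing s with
    | nil => rfl
    | cons n l ih => rw [List.foldl_cons, ih, hc _ h, St.setV_a]

/-- All loop bounds are among the variables `Z`. -/
def BoundsIn (Z : List ℕ) : Cmd → Bool
  | skip => true
  | set _ _ => true
  | put _ _ _ => true
  | seq c c' => c.BoundsIn Z && c'.BoundsIn Z
  | ite _ c c' => c.BoundsIn Z && c'.BoundsIn Z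
  | loop _ z c => Z.contains z && c.BoundsIn Z

/-- A bound on the running time if all loops make at most `M` rounds. -/
def time (M : ℕ) : Cmd → ℕ
  | skip => 0
  | set _ e => e.size + 1
  | put _ e f => e.size + f.size + 7
  | seq c c' => c.time M + c'.time M
  | ite e c c' => e.size + 2 + (c.time M + c'.time M)
  | loop _ _ c => 4 + M * (6 + c.time M)

/-- The variables in `Z` are never written, so the bound M on them persists to every loop that is
reached, however deeply nested. -/
theorem cost_le_time (x : List ℕ) {Z : List ℕ} {M : ℕ} (c : Cmd) (s : St)
    (hb : c.BoundsIn Z = true) (hw : ∀ z ∈ Z, c.WritesV z = false) (hs : ∀ z ∈ Z, s.v z ≤ M) :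
    c.cost x s ≤ c.time M := by
  induction c generalizing s with
  | skip | set | put => exact le_rfl
  | seq c c' hc hc' =>
    simp only [BoundsIn, Bool.and_eq_true] at hb
    simp only [WritesV, Bool.or_eq_false_iff] at hw
    refine add_le_add (hc s hb.1 (fun z hz => (hw z hz).1) hs)
      (hc' _ hb.2 (fun z hz => (hw z hz).2) fun z hz => ?_)
    rw [eval_v_of_not_writesV _ _ _ (hw z hz).1]
    exact hs z hz
  | ite e c c' hc hc' =>
    simp only [BoundsIn, Bool.and_eq_true] at hb
    simp only [WritesV, Bool.or_eq_false_iff] at hw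
    have h1 := hc s hb.1 (fun z hz => (hw z hz).1) hs
    have h2 := hc' s hb.2 (fun z hz => (hw z hz).2) hs
    simp only [cost, time]
    split_ifs <;> omega
  | loop i z c hc =>
    simp only [BoundsIn, Bool.and_eq_true, List.contains_iff_mem] at hb
    simp only [WritesV, Bool.or_eq_false_iff, beq_eq_false_iff_ne] at hw
    simp only [cost, time]
    refine Nat.add_le_add_left ?_ 4
    calc _ ≤ ∑ j ∈ Finset.range (s.v z), (6 + c.time M) := by
          refine Finset.sum_le_sum fun j _ => Nat.add_le_add_left (hc _ hb.2
            (fun z hz => (hw z hz).2) fun y hy => ?_) 6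
          rw [St.setV_v_of_ne _ _ (hw y hy).1.symm]
          generalize List.range j = l
          have : ∀ s' : St, (l.foldl (fun s j => c.eval x (s.setV i j)) s').v y = s'.v y := by
            induction l with
            | nil => intro _; rfl
            | cons n l ih =>
              intro s'
              rw [List.foldl_cons, ih, eval_v_of_not_writesV _ _ _ (hw y hy).2,
                St.setV_v_of_ne _ _ (hw y hy).1.symm]
          rw [this]
          exact hs y hy
      _ = s.v z * (6 + c.time M) := by simp
      _ ≤ _ := Nat.mul_le_mul_right _ (hs z hb.1)

/-- Only loops multiply the time, by M each, and their nesting is fixed by the command; everything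
else adds. So the time is polynomial in M. -/
theorem exists_time_le (c : Cmd) : ∃ C D : ℕ, ∀ M, c.time M ≤ C * (M + 1) ^ D := by
  have mono : ∀ {C D C' D' M : ℕ}, C ≤ C' → D ≤ D' → C * (M + 1) ^ D ≤ C' * (M + 1) ^ D' :=
    fun h h' => Nat.mul_le_mul h (Nat.pow_le_pow_right (Nat.succ_pos _) h')
  induction c with
  | skip | set | put => exact ⟨_, 0, fun M => by rw [pow_zero, mul_one]; exact le_rfl⟩
  | seq c c' hc hc' =>
    obtain ⟨C, D, h⟩ := hc
    obtain ⟨C', D', h'⟩ := hc'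
    refine ⟨C + C', D + D', fun M => ?_⟩
    rw [add_mul]
    exact add_le_add ((h M).trans (mono le_rfl (by omega))) ((h' M).trans (mono le_rfl (by omega)))
  | ite e c c' hc hc' =>
    obtain ⟨C, D, h⟩ := hc
    obtain ⟨C', D', h'⟩ := hc'
    refine ⟨e.size + 2 + (C + C'), D + D', fun M => ?_⟩
    rw [add_mul, add_mul C]
    refine add_le_add ?_ (add_le_add ((h M).trans (mono le_rfl (by omega)))
      ((h' M).trans (mono le_rfl (by omega))))
    exact Nat.le_mul_of_pos_right _ (by positivity)
  | loop i z c hc =>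
    obtain ⟨C, D, h⟩ := hc
    refine ⟨4 + (6 + C), D + 1, fun M => ?_⟩
    have h1 : 1 ≤ (M + 1) ^ D := Nat.one_le_pow _ _ (Nat.succ_pos _)
    have h2 : 6 + c.time M ≤ (6 + C) * (M + 1) ^ D := by have := h M; nlinarith
    have h3 : M * (6 + c.time M) ≤ (6 + C) * (M + 1) ^ (D + 1) := by
      calc M * (6 + c.time M) ≤ (M + 1) * ((6 + C) * (M + 1) ^ D) :=
            Nat.mul_le_mul (Nat.le_succ M) h2
        _ = _ := by ring
    have h4 : 1 ≤ (M + 1) ^ (D + 1) := Nat.one_le_pow _ _ (Nat.succ_pos _)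
    simp only [time]
    nlinarith

/-! ### Proof rules for loops -/

/-- A loop preserves a relation between its state and a fold over an abstract state if its body
does. -/
theorem rel_loop {α : Type*} (x : List ℕ) {i z : ℕ} {c : Cmd} {s : St} {n : ℕ} {R : St → α → Prop}
    {f : α → Fin n → α} {a : α} (hz : s.v z = n) (h0 : R s a)
    (hs : ∀ (s : St) (a : α) (j : Fin n), R s a → R (c.eval x (s.setV i j)) (f a j)) :
    R ((loop i z c).eval x s) ((List.finRange n).foldl f a) := by
  have h : List.range n = (List.finRange n).map Fin.val := by simp
  simp only [eval, hz, h, List.foldl_map]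
  clear h hz
  generalize List.finRange n = l
  induction l generalizing s a with
  | nil => exact h0
  | cons j l ih => exact ih (hs _ _ _ h0)

/-- An invariant of a loop. -/
theorem inv_loop (x : List ℕ) {i z : ℕ} {c : Cmd} {s : St} {R : ℕ → St → Prop}
    (h0 : R 0 s) (hs : ∀ (j : ℕ) (s' : St), j < s.v z → R j s' →
      R (j + 1) (c.eval x (s'.setV i j))) :
    R (s.v z) ((loop i z c).eval x s) := by
  simp only [eval]
  have : ∀ n ≤ s.v z, R n ((List.range n).foldl (fun s j => c.eval x (s.setV i j)) s) := by
    intro n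
    induction n with
    | zero => intro _; exact h0
    | succ n ih =>
      intro hn
      rw [List.range_succ, List.foldl_append]
      exact hs n _ (by omega) (ih (by omega))
  exact this _ le_rfl

end Cmd

end LoopLang

/-! ### An exchange property of transportation problems -/

namespace Transport

open Finset

variable {S : Finset (ℕ × ℕ)}

/-- A nonnegative assignment to the cells in `S` whose row and column sums respect the bounds. -/
def Feasible (S : Finset (ℕ × ℕ)) (r c : ℕ → ℝ) (x : ℕ × ℕ → ℝ) : Prop :=
  (∀ p ∈ S, 0 ≤ x p) ∧ (∀ i, ∑ p ∈ S with p.1 = i, x p ≤ r i) ∧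
    ∀ j, ∑ p ∈ S with p.2 = j, x p ≤ c j

theorem Feasible.le_row {r c : ℕ → ℝ} {x : ℕ × ℕ → ℝ} (h : Feasible S r c x) {p : ℕ × ℕ}
    (hp : p ∈ S) : x p ≤ r p.1 :=
  (single_le_sum (f := x) (fun q hq => h.1 q (mem_filter.1 hq).1)
    (mem_filter.2 ⟨hp, rfl⟩ : p ∈ {q ∈ S | q.1 = p.1})).trans (h.2.1 p.1)

theorem Feasible.le_col {r c : ℕ → ℝ} {x : ℕ × ℕ → ℝ} (h : Feasible S r c x) {p : ℕ × ℕ}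
    (hp : p ∈ S) : x p ≤ c p.2 :=
  (single_le_sum (f := x) (fun q hq => h.1 q (mem_filter.1 hq).1)
    (mem_filter.2 ⟨hp, rfl⟩ : p ∈ {q ∈ S | q.2 = p.2})).trans (h.2.2 p.2)

/-- With fewer equations than cells there is a nontrivial direction. -/
theorem exists_direction (S : Finset (ℕ × ℕ)) (A B : Finset ℕ) (h : #A + #B < #S) :
    ∃ d : ℕ × ℕ → ℝ, (∃ p ∈ S, d p ≠ 0) ∧ (∀ i ∈ A, ∑ p ∈ S with p.1 = i, d p = 0) ∧
      ∀ j ∈ B, ∑ p ∈ S with p.2 = j, d p = 0 := by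
  classical
  let ext : (S → ℝ) →ₗ[ℝ] (ℕ × ℕ → ℝ) :=
    { toFun := fun y p => if hp : p ∈ S then y ⟨p, hp⟩ else 0
      map_add' := fun y y' => by ext p; by_cases hp : p ∈ S <;> simp [hp]
      map_smul' := fun t y => by ext p; by_cases hp : p ∈ S <;> simp [hp] }
  let f : (S → ℝ) →ₗ[ℝ] (A → ℝ) × (B → ℝ) :=
    (LinearMap.pi fun i : A => (∑ p ∈ S with p.1 = i.1, LinearMap.proj p) ∘ₗ ext).prod
      (LinearMap.pi fun j : B => (∑ p ∈ S with p.2 = j.1, LinearMap.proj p) ∘ₗ ext)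
  have hker := LinearMap.ker_ne_bot_of_finrank_lt (f := f) (by simpa using h)
  obtain ⟨y, hy, hy0⟩ := (Submodule.ne_bot_iff _).1 hker
  rw [LinearMap.mem_ker] at hy
  refine ⟨ext y, ?_, fun i hi => ?_, fun j hj => ?_⟩
  · obtain ⟨p, hp⟩ := Function.ne_iff.1 hy0
    exact ⟨p, p.2, by simpa [ext] using hp⟩
  · have := congrFun (congrArg Prod.fst hy) ⟨i, hi⟩
    simpa [f] using this
  · have := congrFun (congrArg Prod.snd hy) ⟨j, hj⟩
    simpa [f] using this

/-- Among the feasible points with the largest sum there is one with the largest sum of squares. -/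
theorem exists_extremal {r c : ℕ → ℝ} {x : ℕ × ℕ → ℝ} (hx : Feasible S r c x) :
    ∃ y, Feasible S r c y ∧ ∑ p ∈ S, x p ≤ ∑ p ∈ S, y p ∧ ∀ z, Feasible S r c z →
      ∑ p ∈ S, z p ≤ ∑ p ∈ S, y p ∧
      (∑ p ∈ S, z p = ∑ p ∈ S, y p → ∑ p ∈ S, z p ^ 2 ≤ ∑ p ∈ S, y p ^ 2) := by
  classical
  -- Fixing the coordinates outside S at 0 makes the feasible set compact in the full product space
  -- and changes no sum over S.
  let F : Set (ℕ × ℕ → ℝ) := {y | Feasible S r c y ∧ ∀ p ∉ S, y p = 0}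
  have hcut : ∀ y, Feasible S r c y → (fun p => if p ∈ S then y p else 0) ∈ F := by
    intro y hy
    refine ⟨⟨fun p hp => by simpa [hp] using hy.1 p hp, fun i => ?_, fun j => ?_⟩,
      fun p hp => by simp [hp]⟩
    · rw [sum_congr rfl fun p hp => if_pos (mem_filter.1 hp).1]; exact hy.2.1 i
    · rw [sum_congr rfl fun p hp => if_pos (mem_filter.1 hp).1]; exact hy.2.2 j
  have hsum : ∀ y : ℕ × ℕ → ℝ, ∑ p ∈ S, (if p ∈ S then y p else 0) = ∑ p ∈ S, y p :=
    fun y => sum_congr rfl fun p hp => if_pos hp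
  have hsq : ∀ y : ℕ × ℕ → ℝ, ∑ p ∈ S, (if p ∈ S then y p else 0) ^ 2 = ∑ p ∈ S, y p ^ 2 :=
    fun y => sum_congr rfl fun p hp => by rw [if_pos hp]
  have hclosed : IsClosed F := by
    have : F = (⋂ p ∈ S, {y | 0 ≤ y p}) ∩ (⋂ i, {y | ∑ p ∈ S with p.1 = i, y p ≤ r i}) ∩
        (⋂ j, {y | ∑ p ∈ S with p.2 = j, y p ≤ c j}) ∩ ⋂ p ∈ {p | p ∉ S}, {y | y p = 0} := by
      ext y; simp [F, Feasible, and_assoc]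
    rw [this]
    refine (((isClosed_biInter fun p _ => ?_).inter (isClosed_iInter fun i => ?_)).inter
      (isClosed_iInter fun j => ?_)).inter (isClosed_biInter fun p _ => ?_)
    · exact isClosed_le continuous_const (continuous_apply p)
    · exact isClosed_le (continuous_finsetSum _ fun p _ => continuous_apply p) continuous_const
    · exact isClosed_le (continuous_finsetSum _ fun p _ => continuous_apply p) continuous_const
    · exact isClosed_eq (continuous_apply p) continuous_const
  have hcompact : IsCompact F := by
    refine (isCompact_univ_pi (s := fun p : ℕ × ℕ => Set.Icc 0 (if p ∈ S then r p.1 else 0))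
      fun p => isCompact_Icc).of_isClosed_subset hclosed fun y hy p _ => ?_
    by_cases hp : p ∈ S
    · simpa [hp] using ⟨hy.1.1 p hp, hy.1.le_row hp⟩
    · simp [hp, hy.2 p hp]
  have hc1 : Continuous fun y : ℕ × ℕ → ℝ => ∑ p ∈ S, y p :=
    continuous_finsetSum _ fun p _ => continuous_apply p
  have hc2 : Continuous fun y : ℕ × ℕ → ℝ => ∑ p ∈ S, y p ^ 2 :=
    continuous_finsetSum _ fun p _ => (continuous_apply p).pow 2
  obtain ⟨y, hyF, hy⟩ := hcompact.exists_isMaxOn ⟨_, hcut x hx⟩ hc1.continuousOn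
  have hcompact' : IsCompact (F ∩ {z | ∑ p ∈ S, z p = ∑ p ∈ S, y p}) :=
    hcompact.inter_right (isClosed_eq hc1 continuous_const)
  obtain ⟨w, hwF, hw⟩ := hcompact'.exists_isMaxOn ⟨y, hyF, rfl⟩ hc2.continuousOn
  have hwy : ∑ p ∈ S, w p = ∑ p ∈ S, y p := hwF.2
  have hle : ∀ z, Feasible S r c z → ∑ p ∈ S, z p ≤ ∑ p ∈ S, w p := fun z hz => by
    have := hy (hcut z hz)
    simp only [Set.mem_ofPred_eq, hsum] at this
    rwa [hwy]
  refine ⟨w, hwF.1.1, hle x hx, fun z hz => ⟨hle z hz, fun he => ?_⟩⟩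
  have := hw (show (fun p => if p ∈ S then z p else 0) ∈ F ∩ {z | ∑ p ∈ S, z p = ∑ p ∈ S, y p} from
    ⟨hcut z hz, by simp only [Set.mem_ofPred_eq, hsum, he, hwy]⟩)
  simpa only [Set.mem_ofPred_eq, hsq] using this

/-- If no cell alone exhausts its row or its column, then there is a nontrivial direction
that keeps the sums of all exhausted rows and columns. -/
theorem exists_tight_direction {r c : ℕ → ℝ} {x : ℕ × ℕ → ℝ} (hS : S.Nonempty)
    (hx : Feasible S r c x) (hsat : ∀ p ∈ S, x p ≠ min (r p.1) (c p.2)) :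
    ∃ d : ℕ × ℕ → ℝ, (∃ p ∈ S, d p ≠ 0) ∧
      (∀ i, ∑ p ∈ S with p.1 = i, x p = r i → ∑ p ∈ S with p.1 = i, d p = 0) ∧
      ∀ j, ∑ p ∈ S with p.2 = j, x p = c j → ∑ p ∈ S with p.2 = j, d p = 0 := by
  classical
  set R := S.image Prod.fst with hR
  set C := S.image Prod.snd with hC
  set A := {i ∈ R | ∑ p ∈ S with p.1 = i, x p = r i} with hA
  set B := {j ∈ C | ∑ p ∈ S with p.2 = j, x p = c j} with hB
  -- If a tight row met S in a single cell, that cell would equal the row bound; being at most the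
  -- column bound, it would equal the minimum, against `hsat`.
  have hrow : ∀ i ∈ A, 2 ≤ #{p ∈ S | p.1 = i} := by
    intro i hi
    by_contra hlt
    obtain ⟨hiR, hi⟩ := mem_filter.1 hi
    obtain ⟨p, hp, rfl⟩ := mem_image.1 hiR
    have hpf : p ∈ {q ∈ S | q.1 = p.1} := mem_filter.2 ⟨hp, rfl⟩
    have h1 : #{q ∈ S | q.1 = p.1} = 1 := by
      have := card_pos.2 ⟨p, hpf⟩; omega
    obtain ⟨q, hq⟩ := card_eq_one.1 h1
    rw [hq, mem_singleton] at hpf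
    subst hpf
    rw [hq, sum_singleton] at hi
    exact hsat p hp (by rw [← hi, min_eq_left (hx.le_col hp)])
  have hcol : ∀ j ∈ B, 2 ≤ #{p ∈ S | p.2 = j} := by
    intro j hj
    by_contra hlt
    obtain ⟨hjC, hj⟩ := mem_filter.1 hj
    obtain ⟨p, hp, rfl⟩ := mem_image.1 hjC
    have hpf : p ∈ {q ∈ S | q.2 = p.2} := mem_filter.2 ⟨hp, rfl⟩
    have h1 : #{q ∈ S | q.2 = p.2} = 1 := by
      have := card_pos.2 ⟨p, hpf⟩; omega
    obtain ⟨q, hq⟩ := card_eq_one.1 h1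
    rw [hq, mem_singleton] at hpf
    subst hpf
    rw [hq, sum_singleton] at hj
    exact hsat p hp (by rw [← hj, min_eq_right (hx.le_row hp)])
  have hAR : A ⊆ R := filter_subset _ _
  have hBC : B ⊆ C := filter_subset _ _
  -- Each row that meets S has one cell, and each tight row a second one.
  have hcountR : #A + #R ≤ #S := by
    rw [card_eq_sum_card_image Prod.fst S, ← hR]
    calc #A + #R = ∑ i ∈ R, ((if i ∈ A then 1 else 0) + 1) := by
          rw [sum_add_distrib, sum_boole, filter_mem_eq_inter, inter_eq_right.2 hAR]; simp
      _ ≤ _ := sum_le_sum fun i hi => by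
          split_ifs with h
          · exact hrow i h
          · obtain ⟨p, hp, rfl⟩ := mem_image.1 hi
            exact card_pos.2 ⟨p, mem_filter.2 ⟨hp, rfl⟩⟩
  have hcountC : #B + #C ≤ #S := by
    rw [card_eq_sum_card_image Prod.snd S, ← hC]
    calc #B + #C = ∑ i ∈ C, ((if i ∈ B then 1 else 0) + 1) := by
          rw [sum_add_distrib, sum_boole, filter_mem_eq_inter, inter_eq_right.2 hBC]; simp
      _ ≤ _ := sum_le_sum fun i hi => by
          split_ifs with h
          · exact hcol i h
          · obtain ⟨p, hp, rfl⟩ := mem_image.1 hi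
            exact card_pos.2 ⟨p, mem_filter.2 ⟨hp, rfl⟩⟩
  have hlift : ∀ d : ℕ × ℕ → ℝ, (∀ i ∈ A, ∑ p ∈ S with p.1 = i, d p = 0) →
      (∀ j ∈ B, ∑ p ∈ S with p.2 = j, d p = 0) →
      (∀ i, ∑ p ∈ S with p.1 = i, x p = r i → ∑ p ∈ S with p.1 = i, d p = 0) ∧
      ∀ j, ∑ p ∈ S with p.2 = j, x p = c j → ∑ p ∈ S with p.2 = j, d p = 0 := by
    intro d h1 h2
    refine ⟨fun i hi => ?_, fun j hj => ?_⟩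
    · by_cases hiR : i ∈ R
      · exact h1 i (mem_filter.2 ⟨hiR, hi⟩)
      · rw [filter_false_of_mem fun p hp h => hiR (mem_image.2 ⟨p, hp, h⟩), sum_empty]
    · by_cases hjC : j ∈ C
      · exact h2 j (mem_filter.2 ⟨hjC, hj⟩)
      · rw [filter_false_of_mem fun p hp h => hjC (mem_image.2 ⟨p, hp, h⟩), sum_empty]
  have hAc := card_le_card hAR
  have hBc := card_le_card hBC
  rcases lt_or_ge (#A + #B) #S with hlt | hge
  · obtain ⟨d, hd, h1, h2⟩ := exists_direction S A B hlt
    exact ⟨d, hd, hlift d h1 h2⟩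
  -- The two counts give #R + #C ≤ #S ≤ #A + #B, so every row and column is tight. Row sums and
  -- column sums have the same total, so one equation is redundant: it is dropped to gain a
  -- direction and recovered afterwards.
  · have hA' : A = R := eq_of_subset_of_card_le hAR (by omega)
    have hB' : B = C := eq_of_subset_of_card_le hBC (by omega)
    obtain ⟨q, hq⟩ := hS
    have hqA : q.1 ∈ A := hA' ▸ mem_image_of_mem _ hq
    obtain ⟨d, hd, h1, h2⟩ := exists_direction S (A.erase q.1) B (by
      rw [card_erase_of_mem hqA]; have := card_pos.2 ⟨_, hqA⟩; rw [hA', hB'] at *; omega)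
    refine ⟨d, hd, hlift d (fun i hi => ?_) h2⟩
    by_cases hiq : i = q.1
    · have ht1 : ∑ p ∈ S, d p = 0 := by
        rw [← sum_fiberwise_of_maps_to (g := Prod.snd) (t := C)
          (fun p hp => mem_image_of_mem _ hp)]
        exact sum_eq_zero fun j hj => h2 j (hB' ▸ hj)
      rw [← sum_fiberwise_of_maps_to (g := Prod.fst) (t := R)
          (fun p hp => mem_image_of_mem _ hp), ← hA', ← add_sum_erase _ _ hqA,
          sum_eq_zero h1, add_zero] at ht1
      rw [hiq]; exact ht1
    · exact h1 i (mem_erase.2 ⟨hiq, hi⟩)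

/-- A feasible point can be replaced by one with at least the same sum in which some cell is `0` or
exhausts its row or its column. -/
theorem exists_zero_or_saturated {r c : ℕ → ℝ} {x : ℕ × ℕ → ℝ} (hS : S.Nonempty)
    (hx : Feasible S r c x) :
    ∃ y, Feasible S r c y ∧ ∑ p ∈ S, x p ≤ ∑ p ∈ S, y p ∧
      ∃ p ∈ S, y p = 0 ∨ y p = min (r p.1) (c p.2) := by
  obtain ⟨y, hy, hxy, hmax⟩ := exists_extremal hx
  refine ⟨y, hy, hxy, ?_⟩
  by_contra! hne
  obtain ⟨d, ⟨q, hq, hdq⟩, hdR, hdC⟩ := exists_tight_direction hS hy fun p hp => (hne p hp).2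
  have hsum : ∀ (T : Finset (ℕ × ℕ)) (t : ℝ),
      ∑ p ∈ T, (y p + t * d p) = ∑ p ∈ T, y p + t * ∑ p ∈ T, d p := fun T t => by
    rw [sum_add_distrib, mul_sum]
  -- Tight constraints do not change along `d`, and all others hold strictly at `y`, so small moves
  -- in both directions remain feasible.
  have hev : ∀ᶠ t : ℝ in nhds 0, Feasible S r c fun p => y p + t * d p := by
    have hlin : ∀ a b : ℝ, Filter.Tendsto (fun t : ℝ => a + t * b) (nhds 0) (nhds a) := by
      intro a b
      have : Continuous fun t : ℝ => a + t * b := by fun_prop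
      simpa using this.tendsto 0
    have h1 : ∀ᶠ t : ℝ in nhds 0, ∀ p ∈ S, 0 ≤ y p + t * d p := by
      rw [Filter.eventually_all_finset]
      intro p hp
      filter_upwards [(hlin (y p) (d p)).eventually_const_lt
        (lt_of_le_of_ne (hy.1 p hp) (hne p hp).1.symm)] with t ht using ht.le
    have h2 : ∀ᶠ t : ℝ in nhds 0, ∀ i ∈ S.image Prod.fst,
        ∑ p ∈ S with p.1 = i, (y p + t * d p) ≤ r i := by
      rw [Filter.eventually_all_finset]
      intro i _
      simp only [hsum]
      by_cases hi : ∑ p ∈ S with p.1 = i, y p = r i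
      · simp [hdR i hi, hi]
      · filter_upwards [(hlin _ _).eventually_lt_const
          (lt_of_le_of_ne (hy.2.1 i) hi)] with t ht using ht.le
    have h3 : ∀ᶠ t : ℝ in nhds 0, ∀ j ∈ S.image Prod.snd,
        ∑ p ∈ S with p.2 = j, (y p + t * d p) ≤ c j := by
      rw [Filter.eventually_all_finset]
      intro j _
      simp only [hsum]
      by_cases hj : ∑ p ∈ S with p.2 = j, y p = c j
      · simp [hdC j hj, hj]
      · filter_upwards [(hlin _ _).eventually_lt_const
          (lt_of_le_of_ne (hy.2.2 j) hj)] with t ht using ht.le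
    filter_upwards [h1, h2, h3] with t h1 h2 h3
    refine ⟨h1, fun i => ?_, fun j => ?_⟩
    · by_cases hi : i ∈ S.image Prod.fst
      · exact h2 i hi
      · have := hy.2.1 i
        rw [filter_false_of_mem fun p hp h => hi (mem_image.2 ⟨p, hp, h⟩)] at *
        exact this
    · by_cases hj : j ∈ S.image Prod.snd
      · exact h3 j hj
      · have := hy.2.2 j
        rw [filter_false_of_mem fun p hp h => hj (mem_image.2 ⟨p, hp, h⟩)] at *
        exact this
  obtain ⟨δ, hδ, hball⟩ := Metric.eventually_nhds_iff.1 hev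
  have hpos := hball (y := δ / 2) (by rw [Real.dist_eq, sub_zero, abs_of_pos] <;> linarith)
  have hneg := hball (y := -(δ / 2))
    (by rw [Real.dist_eq, sub_zero, abs_neg, abs_of_pos] <;> linarith)
  have hp1 := (hmax _ hpos).1
  have hn1 := (hmax _ hneg).1
  rw [hsum] at hp1 hn1
  have h0 : δ / 2 * ∑ p ∈ S, d p = 0 := by linarith
  have hp2 := (hmax _ hpos).2 (by rw [hsum]; linarith)
  have hn2 := (hmax _ hneg).2 (by rw [hsum]; linarith)
  -- Both moves are feasible, so maximality forces the total of `d` to vanish. By this identity the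
  -- two sums of squares then average to strictly more than that of `y`.
  have hid : ∑ p ∈ S, (y p + δ / 2 * d p) ^ 2 + ∑ p ∈ S, (y p + -(δ / 2) * d p) ^ 2 =
      2 * ∑ p ∈ S, y p ^ 2 + 2 * ((δ / 2) ^ 2 * ∑ p ∈ S, d p ^ 2) := by
    rw [mul_sum, mul_sum, mul_sum, ← sum_add_distrib, ← sum_add_distrib]
    exact sum_congr rfl fun p _ => by ring
  have hd2 : 0 < ∑ p ∈ S, d p ^ 2 :=
    sum_pos' (fun p _ => sq_nonneg _) ⟨q, hq, by positivity⟩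
  have : 0 < (δ / 2) ^ 2 * ∑ p ∈ S, d p ^ 2 := by positivity
  linarith

end Transport

/-! ### Greedy common induced subgraphs -/

namespace Greedy

open Finset

variable {V W : Type*} (G : SimpleGraph V) (H : SimpleGraph W) (c : V → ℕ) (d : W → ℕ)

/-- Two pairs of vertices can occur together in an isomorphism between induced subgraphs. -/
def Compat (p q : V × W) : Prop :=
  p.1 ≠ q.1 ∧ p.2 ≠ q.2 ∧ (G.Adj p.1 q.1 ↔ H.Adj p.2 q.2)

theorem Compat.symm {p q : V × W} (h : Compat G H p q) : Compat G H q p :=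
  ⟨h.1.symm, h.2.1.symm, by rw [G.adj_comm, H.adj_comm]; exact h.2.2⟩

instance : Std.Symm (Compat G H) := ⟨fun _ _ h => h.symm⟩

/-- The isomorphisms between induced subgraphs, as lists of pairs of vertices. -/
def Valid (L : List (V × W)) : Prop := L.Pairwise (Compat G H)

/-- The pair of classes to which a pair of vertices belongs. -/
def cls (q : V × W) : ℕ × ℕ := (c q.1, d q.2)

open Classical in
/-- Append `q` if it belongs to the classes `t` and is compatible with the pairs present. -/
noncomputable def tryAdd (t : ℕ × ℕ) (L : List (V × W)) (q : V × W) : List (V × W) :=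
  if cls c d q = t ∧ ∀ p ∈ L, Compat G H p q then L ++ [q] else L

/-- Append as many pairs from the classes `t` as possible. -/
noncomputable def phase (us : List V) (vs : List W) (L : List (V × W)) (t : ℕ × ℕ) :
    List (V × W) :=
  us.foldl (fun L u => vs.foldl (fun L v => tryAdd G H c d t L (u, v)) L) L

/-- A rejected pair of the right cell conflicts with an entry already present, and entries are never
removed; an accepted pair conflicts with itself, since compatible pairs are disjoint. So a single
pass already gives a maximal extension. -/
theorem foldl_tryAdd (t : ℕ × ℕ) (l L : List (V × W)) :
    ∃ Q, l.foldl (tryAdd G H c d t) L = L ++ Q ∧ (∀ q ∈ Q, cls c d q = t) ∧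
      (Valid G H L → Valid G H (L ++ Q)) ∧
      ∀ q ∈ l, cls c d q = t → ∃ p ∈ L ++ Q, ¬ Compat G H p q := by
  induction l generalizing L with
  | nil => exact ⟨[], by simp⟩
  | cons a l ih =>
    rw [List.foldl_cons, tryAdd]
    split_ifs with h
    · obtain ⟨Q, h1, h2, h3, h4⟩ := ih (L ++ [a])
      refine ⟨a :: Q, by simp [h1], ?_, fun hL => ?_, ?_⟩
      · simpa [h.1] using h2
      · rw [List.append_cons]
        exact h3 (List.pairwise_append.2 ⟨hL, List.pairwise_singleton _ _, by simpa using h.2⟩)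
      · intro q hq hqt
        rw [List.append_cons]
        rcases List.mem_cons.1 hq with rfl | hq
        · exact ⟨q, by simp, fun h => h.1 rfl⟩
        · exact h4 q hq hqt
    · obtain ⟨Q, h1, h2, h3, h4⟩ := ih L
      refine ⟨Q, h1, h2, h3, fun q hq hqt => ?_⟩
      rcases List.mem_cons.1 hq with rfl | hq
      · have : ∃ p ∈ L, ¬ Compat G H p q := by
          by_contra! hcon
          exact h ⟨hqt, hcon⟩
        obtain ⟨p, hp, hpq⟩ := this
        exact ⟨p, by simp [hp], hpq⟩
      · exact h4 q hq hqt

theorem phase_spec {us : List V} {vs : List W} (hus : ∀ u, u ∈ us) (hvs : ∀ v, v ∈ vs)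
    (L : List (V × W)) (t : ℕ × ℕ) :
    ∃ Q, phase G H c d us vs L t = L ++ Q ∧ (∀ q ∈ Q, cls c d q = t) ∧
      (Valid G H L → Valid G H (L ++ Q)) ∧
      ∀ q, cls c d q = t → ∃ p ∈ L ++ Q, ¬ Compat G H p q := by
  have hph : phase G H c d us vs L t = (us.product vs).foldl (tryAdd G H c d t) L := by
    simp only [phase, List.product, List.foldl_flatMap, List.foldl_map]
  obtain ⟨Q, h1, h2, h3, h4⟩ := foldl_tryAdd G H c d t (us.product vs) L
  exact ⟨Q, hph.trans h1, h2, h3, fun q => h4 q (List.mem_product.2 ⟨hus _, hvs _⟩)⟩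

theorem length_le_phase {us : List V} {vs : List W} (hus : ∀ u, u ∈ us) (hvs : ∀ v, v ∈ vs)
    (L : List (V × W)) (t : ℕ × ℕ) : L.length ≤ (phase G H c d us vs L t).length := by
  obtain ⟨Q, h, -⟩ := phase_spec G H c d hus hvs L t
  simp [h]

theorem valid_phase {us : List V} {vs : List W} (hus : ∀ u, u ∈ us) (hvs : ∀ v, v ∈ vs)
    {L : List (V × W)} (t : ℕ × ℕ) (hL : Valid G H L) : Valid G H (phase G H c d us vs L t) := by
  obtain ⟨Q, h, -, h3, -⟩ := phase_spec G H c d hus hvs L t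
  rw [h]; exact h3 hL

variable {G H c d}

/-- Adjacency depends on the twin classes only. -/
theorem adj_congr_of_twins (hc : ∀ u u', c u = c u' → G.Twins u u') {u u' a a' : V}
    (hu : u ≠ u') (ha : a ≠ a') (h : c u = c a) (h' : c u' = c a') :
    G.Adj u u' ↔ G.Adj a a' := by
  -- Endpoints are exchanged one at a time, and being twins says nothing about the adjacency of the
  -- twins themselves. If `u' = a`, then `u` cannot be exchanged for `a`, but all four vertices lie
  -- in one class and `u` can be exchanged for `a'`.
  by_cases hua : u' = a
  · subst hua
    by_cases hua' : u = a'
    · subst hua'; exact G.adj_comm _ _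
    · rw [(G.twins_iff u a').1 (hc _ _ (h.trans h')) u' hu.symm ha, G.adj_comm]
  · rw [(G.twins_iff u a).1 (hc _ _ h) u' hu.symm hua, G.adj_comm,
      (G.twins_iff u' a').1 (hc _ _ h') a (Ne.symm hua) ha, G.adj_comm]

/-- This is what reduces the problem from vertices to cells: one compatible couple of pairs
certifies all disjoint couples from the same two cells. -/
theorem compat_of_cls_eq (hc : ∀ u u', c u = c u' → G.Twins u u')
    (hd : ∀ v v', d v = d v' → H.Twins v v') {p q p' q' : V × W} (h : Compat G H p q)
    (h1 : p'.1 ≠ q'.1) (h2 : p'.2 ≠ q'.2) (hp : cls c d p' = cls c d p)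
    (hq : cls c d q' = cls c d q) : Compat G H p' q' := by
  simp only [cls, Prod.mk.injEq] at hp hq
  exact ⟨h1, h2, by
    rw [adj_congr_of_twins hc h1 h.1 hp.1 hq.1, adj_congr_of_twins hd h2 h.2.1 hp.2 hq.2]
    exact h.2.2⟩

theorem Valid.nodup_fst {L : List (V × W)} (h : Valid G H L) : (L.map Prod.fst).Nodup :=
  List.pairwise_map.2 (h.imp fun h => h.1)

theorem Valid.nodup_snd {L : List (V × W)} (h : Valid G H L) : (L.map Prod.snd).Nodup :=
  List.pairwise_map.2 (h.imp fun h => h.2.1)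

/-! ### Unused vertices of a class -/

section Residual

variable {U : Type*} [Fintype U]

/-- The number of vertices of class `i` that do not occur in the list `l`. -/
noncomputable def residual (e : U → ℕ) (l : List U) (i : ℕ) : ℝ :=
  (#{u | e u = i} : ℝ) - (l.countP fun u => decide (e u = i) : ℕ)

theorem countP_le_card (e : U → ℕ) {l : List U} (hl : l.Nodup) (i : ℕ) :
    (l.countP fun u => decide (e u = i)) ≤ #{u | e u = i} := by
  classical
  rw [List.countP_eq_length_filter, ← List.toFinset_card_of_nodup (hl.filter _)]
  exact card_le_card fun u hu => by simpa using (List.mem_filter.1 (List.mem_toFinset.1 hu)).2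

theorem residual_nonneg (e : U → ℕ) {l : List U} (hl : l.Nodup) (i : ℕ) :
    0 ≤ residual e l i := by
  have := countP_le_card e hl i
  rw [residual, sub_nonneg]
  exact_mod_cast this

theorem exists_of_residual_pos (e : U → ℕ) {l : List U} {i : ℕ} (h : 0 < residual e l i) :
    ∃ u, e u = i ∧ u ∉ l := by
  classical
  by_contra! hcon
  rw [residual, sub_pos, Nat.cast_lt, List.countP_eq_length_filter] at h
  refine absurd h (not_lt.2 (le_trans (card_le_card fun u hu => ?_) (List.toFinset_card_le _)))
  have hu' : e u = i := by simpa using hu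
  exact List.mem_toFinset.2 (List.mem_filter.2 ⟨hcon u hu', by simpa using hu'⟩)

end Residual

/-! ### Mixed cells and the greedy exchange argument -/

variable (G H c d) in
/-- Some two pairs of vertices from the classes `t` are incompatible. -/
def Mixed (t : ℕ × ℕ) : Prop :=
  ∃ p q : V × W, cls c d p = t ∧ cls c d q = t ∧ p.1 ≠ q.1 ∧ p.2 ≠ q.2 ∧ ¬ Compat G H p q

variable (G H c d) in
/-- The pairs in `L` and the unused pairs with classes in `S` are compatible, except inside mixed
pairs of classes. -/
structure Good (L : List (V × W)) (S : Finset (ℕ × ℕ)) : Prop where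
  valid : Valid G H L
  compat_left : ∀ p ∈ L, ∀ q, cls c d q ∈ S → q.1 ∉ L.map Prod.fst → q.2 ∉ L.map Prod.snd →
    Compat G H p q
  compat_right : ∀ p q, cls c d p ∈ S → cls c d q ∈ S → cls c d p ≠ cls c d q → p.1 ≠ q.1 →
    p.2 ≠ q.2 → Compat G H p q

/-- The new pairs lie in `t`, so `compat_right` makes them compatible with all unused pairs of the
other cells. Within `t` itself this may fail, which is why `t` leaves S. -/
theorem Good.append {L Q : List (V × W)} {S : Finset (ℕ × ℕ)} {t : ℕ × ℕ} (h : Good G H c d L S)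
    (ht : t ∈ S) (hQ : ∀ q ∈ Q, cls c d q = t) (hv : Valid G H (L ++ Q)) :
    Good G H c d (L ++ Q) (S.erase t) := by
  refine ⟨hv, fun p hp q hq h1 h2 => ?_, fun p q hp hq =>
    h.compat_right p q (mem_of_mem_erase hp) (mem_of_mem_erase hq)⟩
  simp only [List.map_append, List.mem_append, not_or] at h1 h2
  rcases List.mem_append.1 hp with hp | hp
  · exact h.compat_left p hp q (mem_of_mem_erase hq) h1.1 h2.1
  · refine h.compat_right p q (by rwa [hQ p hp]) (mem_of_mem_erase hq) ?_ ?_ ?_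
    · rw [hQ p hp]; exact (ne_of_mem_erase hq).symm
    · exact fun he => h1.2 (he ▸ List.mem_map_of_mem hp)
    · exact fun he => h2.2 (he ▸ List.mem_map_of_mem hp)

theorem residual_fst_append [Fintype V] (L : List (V × W)) {Q : List (V × W)} {t : ℕ × ℕ}
    (hQ : ∀ q ∈ Q, cls c d q = t) (i : ℕ) :
    residual c ((L ++ Q).map Prod.fst) i =
      residual c (L.map Prod.fst) i - if t.1 = i then (Q.length : ℝ) else 0 := by
  have : ((Q.map Prod.fst).countP fun u => decide (c u = i)) = if t.1 = i then Q.length else 0 := by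
    have hq : ∀ q ∈ Q, c q.1 = t.1 := fun q hq => by rw [← hQ q hq]; rfl
    rw [List.countP_map]
    split_ifs with h
    · exact List.countP_eq_length.2 fun q hq' => by simp [hq q hq', h]
    · exact List.countP_eq_zero.2 fun q hq' => by simp [hq q hq', h]
  rw [residual, residual, List.map_append, List.countP_append, this]
  split_ifs <;> push_cast <;> ring

variable [Fintype W]

theorem residual_snd_append (L : List (V × W)) {Q : List (V × W)} {t : ℕ × ℕ}
    (hQ : ∀ q ∈ Q, cls c d q = t) (j : ℕ) :
    residual d ((L ++ Q).map Prod.snd) j =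
      residual d (L.map Prod.snd) j - if t.2 = j then (Q.length : ℝ) else 0 := by
  have : ((Q.map Prod.snd).countP fun u => decide (d u = j)) = if t.2 = j then Q.length else 0 := by
    have hq : ∀ q ∈ Q, d q.2 = t.2 := fun q hq => by rw [← hQ q hq]; rfl
    rw [List.countP_map]
    split_ifs with h
    · exact List.countP_eq_length.2 fun q hq' => by simp [hq q hq', h]
    · exact List.countP_eq_zero.2 fun q hq' => by simp [hq q hq', h]
  rw [residual, residual, List.map_append, List.countP_append, this]
  split_ifs <;> push_cast <;> ring

variable [Fintype V]

open Transport in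
/-- A cell with a suitable value can be taken out of a feasible point. -/
theorem feasible_erase {L Q : List (V × W)} {S : Finset (ℕ × ℕ)} {t : ℕ × ℕ} {x : ℕ × ℕ → ℝ}
    (hx : Feasible S (residual c (L.map Prod.fst)) (residual d (L.map Prod.snd)) x) (ht : t ∈ S)
    (hQ : ∀ q ∈ Q, cls c d q = t) (hlen : (Q.length : ℝ) = x t) :
    Feasible (S.erase t) (residual c ((L ++ Q).map Prod.fst)) (residual d ((L ++ Q).map Prod.snd))
      x := by
  have hsum : ∀ P : ℕ × ℕ → Prop, ∀ [DecidablePred P], ∑ p ∈ S.erase t with P p, x p =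
      ∑ p ∈ S with P p, x p - if P t then x t else 0 := by
    intro P _
    rw [filter_erase]
    split_ifs with h
    · rw [sum_erase_eq_sub (mem_filter.2 ⟨ht, h⟩)]
    · rw [erase_eq_of_notMem (by simp [h]), sub_zero]
  refine ⟨fun p hp => hx.1 p (mem_of_mem_erase hp), fun i => ?_, fun j => ?_⟩
  · rw [hsum, residual_fst_append L hQ, hlen]
    exact sub_le_sub_right (hx.2.1 i) _
  · rw [hsum, residual_snd_append L hQ, hlen]
    exact sub_le_sub_right (hx.2.2 j) _

/-- A phase exhausts one of its two classes, unless they are mixed. -/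
theorem length_phase_of_not_mixed {L Q : List (V × W)} {S : Finset (ℕ × ℕ)} {t : ℕ × ℕ}
    (h : Good G H c d L S) (ht : t ∈ S) (hQ : ∀ q ∈ Q, cls c d q = t) (hv : Valid G H (L ++ Q))
    (hmax : ∀ q, cls c d q = t → ∃ p ∈ L ++ Q, ¬ Compat G H p q) (hm : ¬ Mixed G H c d t) :
    (Q.length : ℝ) = min (residual c (L.map Prod.fst) t.1) (residual d (L.map Prod.snd) t.2) := by
  have h1 := residual_fst_append L hQ t.1
  have h2 := residual_snd_append L hQ t.2
  rw [if_pos rfl] at h1 h2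
  have h3 := residual_nonneg c hv.nodup_fst t.1
  have h4 := residual_nonneg d hv.nodup_snd t.2
  -- If both classes had a vertex left, the pair of these two would be blocked by an entry of `L ++
  -- Q`. An entry of `L` contradicts `Good`, and an entry of `Q` shows that the cell is mixed.
  have h5 : residual c ((L ++ Q).map Prod.fst) t.1 = 0 ∨
      residual d ((L ++ Q).map Prod.snd) t.2 = 0 := by
    by_contra! hne
    obtain ⟨u, hu, hu'⟩ := exists_of_residual_pos c (lt_of_le_of_ne h3 hne.1.symm)
    obtain ⟨v, hv', hv''⟩ := exists_of_residual_pos d (lt_of_le_of_ne h4 hne.2.symm)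
    have hcls : cls c d (u, v) = t := Prod.ext hu hv'
    obtain ⟨p, hp, hpq⟩ := hmax (u, v) hcls
    rw [List.map_append, List.mem_append, not_or] at hu' hv''
    rcases List.mem_append.1 hp with hp | hp
    · exact hpq (h.compat_left p hp _ (by rwa [hcls]) hu'.1 hv''.1)
    · exact hm ⟨p, (u, v), hQ p hp, hcls, fun he => hu'.2 (List.mem_map.2 ⟨p, hp, he⟩),
        fun he => hv''.2 (List.mem_map.2 ⟨p, hp, he⟩), hpq⟩
  rcases h5 with h5 | h5
  · rw [min_eq_left] <;> linarith
  · rw [min_eq_right] <;> linarith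

/-- A phase with mixed classes adds one pair. -/
theorem length_phase_of_mixed (hc : ∀ u u', c u = c u' → G.Twins u u')
    (hd : ∀ v v', d v = d v' → H.Twins v v') {L Q : List (V × W)} {S : Finset (ℕ × ℕ)}
    {t : ℕ × ℕ} (h : Good G H c d L S) (ht : t ∈ S) (hQ : ∀ q ∈ Q, cls c d q = t)
    (hv : Valid G H (L ++ Q)) (hmax : ∀ q, cls c d q = t → ∃ p ∈ L ++ Q, ¬ Compat G H p q)
    (hm : Mixed G H c d t) (h1 : 0 < residual c (L.map Prod.fst) t.1)
    (h2 : 0 < residual d (L.map Prod.snd) t.2) : Q.length = 1 := by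
  -- With no new pair, two unused vertices would form a pair blocked by `L`, against `Good`. With
  -- two new pairs, all disjoint pairs of the cell would be compatible, so it would not be mixed.
  match Q, hQ, hv, hmax with
  | [], hQ, hv, hmax =>
    obtain ⟨u, hu, hu'⟩ := exists_of_residual_pos c h1
    obtain ⟨v, hv', hv''⟩ := exists_of_residual_pos d h2
    have hcls : cls c d (u, v) = t := Prod.ext hu hv'
    obtain ⟨p, hp, hpq⟩ := hmax (u, v) hcls
    rw [List.append_nil] at hp
    exact absurd (h.compat_left p hp _ (by rwa [hcls]) hu' hv'') hpq
  | [_], _, _, _ => rfl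
  | a :: b :: Q, hQ, hv, hmax =>
    obtain ⟨p, q, hp, hq, hpq1, hpq2, hpq⟩ := hm
    have hab : Compat G H a b := by
      have := (List.pairwise_append.1 hv).2.1
      exact (List.pairwise_cons.1 this).1 b (by simp)
    exact absurd (compat_of_cls_eq hc hd hab hpq1 hpq2 (by rw [hp, hQ a (by simp)])
      (by rw [hq, hQ b (by simp)])) hpq

open Transport in
/-- Some sequence of phases does at least as well as a given feasible point. -/
theorem exists_phases (hc : ∀ u u', c u = c u' → G.Twins u u')
    (hd : ∀ v v', d v = d v' → H.Twins v v') {us : List V} {vs : List W} (hus : ∀ u, u ∈ us)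
    (hvs : ∀ v, v ∈ vs) (S : Finset (ℕ × ℕ)) (L : List (V × W)) (x : ℕ × ℕ → ℝ)
    (h : Good G H c d L S)
    (hx : Feasible S (residual c (L.map Prod.fst)) (residual d (L.map Prod.snd)) x)
    (hm : ∀ t ∈ S, Mixed G H c d t → x t = 1) :
    ∃ l : List (ℕ × ℕ), (∀ t ∈ l, t ∈ S) ∧ l.length ≤ #S ∧
      (L.length : ℝ) + ∑ t ∈ S, x t ≤ (l.foldl (phase G H c d us vs) L).length := by
  induction hn : #S generalizing S L x with
  | zero =>
    rw [card_eq_zero] at hn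
    subst hn
    exact ⟨[], by simp⟩
  | succ n ih =>
    have hne : S.Nonempty := card_pos.1 (by omega)
    -- It suffices to move, without loss, to a point with a cell that can be dropped or whose value
    -- is exactly the gain of a phase. Taking that cell out leaves a feasible point for the residual
    -- bounds.
    suffices hstep : ∃ y, Feasible S (residual c (L.map Prod.fst)) (residual d (L.map Prod.snd)) y ∧
        ∑ t ∈ S, x t ≤ ∑ t ∈ S, y t ∧ (∀ t ∈ S, Mixed G H c d t → y t = 1) ∧
        ∃ t ∈ S, y t = 0 ∨ ((phase G H c d us vs L t).length : ℝ) = L.length + y t by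
      obtain ⟨y, hy, hxy, hmy, t, ht, hyt⟩ := hstep
      have hcard : #(S.erase t) = n := by rw [card_erase_of_mem ht]; omega
      have hsum := add_sum_erase S y ht
      rcases hyt with hyt | hyt
      · have hy' := feasible_erase (Q := []) hy ht (by simp) (by simp [hyt])
        have h' := h.append (Q := []) ht (by simp) (by simpa using h.valid)
        rw [List.append_nil] at hy' h'
        obtain ⟨l, h1, h2, h3⟩ := ih _ L y h' hy'
          (fun t ht => hmy t (mem_of_mem_erase ht)) hcard
        exact ⟨l, fun t ht => mem_of_mem_erase (h1 t ht), by omega, by linarith⟩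
      · obtain ⟨Q, hQ1, hQ2, hQ3, -⟩ := phase_spec G H c d hus hvs L t
        have hQlen : (Q.length : ℝ) = y t := by
          rw [hQ1, List.length_append, Nat.cast_add] at hyt; linarith
        obtain ⟨l, h1, h2, h3⟩ := ih _ (L ++ Q) y (h.append ht hQ2 (hQ3 h.valid))
          (feasible_erase hy ht hQ2 hQlen) (fun t ht => hmy t (mem_of_mem_erase ht)) hcard
        refine ⟨t :: l, ?_, by simp only [List.length_cons]; omega, ?_⟩
        · rintro s hs
          rcases List.mem_cons.1 hs with rfl | hs
          · exact ht
          · exact mem_of_mem_erase (h1 s hs)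
        · rw [List.foldl_cons, hQ1]
          rw [List.length_append, Nat.cast_add] at h3
          linarith
    -- Mixed cells are processed first: there the point is kept, since the exchange could destroy
    -- their value 1. Once none is left, the exchange is unrestricted.
    by_cases hmix : ∃ t ∈ S, Mixed G H c d t
    · obtain ⟨t, ht, hmt⟩ := hmix
      refine ⟨x, hx, le_rfl, hm, t, ht, Or.inr ?_⟩
      obtain ⟨Q, hQ1, hQ2, hQ3, hQ4⟩ := phase_spec G H c d hus hvs L t
      have hxt := hm t ht hmt
      have h1 := hx.le_row ht
      have h2 := hx.le_col ht
      rw [hQ1, List.length_append, length_phase_of_mixed hc hd h ht hQ2 (hQ3 h.valid) hQ4 hmt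
        (by linarith) (by linarith), hxt]
      push_cast; rfl
    · push Not at hmix
      obtain ⟨y, hy, hxy, t, ht, hyt⟩ := exists_zero_or_saturated hne hx
      refine ⟨y, hy, hxy, fun t ht hmt => absurd hmt (hmix t ht), t, ht, hyt.imp_right fun hyt => ?_⟩
      obtain ⟨Q, hQ1, hQ2, hQ3, hQ4⟩ := phase_spec G H c d hus hvs L t
      rw [hQ1, List.length_append, Nat.cast_add,
        length_phase_of_not_mixed h ht hQ2 (hQ3 h.valid) hQ4 (hmix t ht), hyt]

/-- Double counting: each list entry is counted at its own value. It identifies the row and column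
sums of the multiplicities of cells with the number of vertices used in a class. -/
theorem sum_countP_eq {α : Type*} [DecidableEq α] (l : List α) (P : α → Prop) [DecidablePred P] :
    ∑ t ∈ l.toFinset with P t, l.countP (fun s => decide (s = t)) =
      l.countP fun t => decide (P t) := by
  rw [List.countP_eq_length_filter,
    ← List.sum_toFinset_count_eq_length (l.filter fun t => decide (P t)), List.toFinset_filter]
  refine sum_congr (by simp) fun t ht => ?_
  rw [List.count_filter (by simpa using (mem_filter.1 ht).2)]
  rfl

/-- Some sequence of phases is at least as good as any given common induced subgraph. -/
theorem exists_phases_of_valid (hc : ∀ u u', c u = c u' → G.Twins u u')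
    (hd : ∀ v v', d v = d v' → H.Twins v v') {us : List V} {vs : List W} (hus : ∀ u, u ∈ us)
    (hvs : ∀ v, v ∈ vs) {k k' : ℕ} (hk : ∀ u, c u < k) (hk' : ∀ v, d v < k')
    {M : List (V × W)} (hM : Valid G H M) :
    ∃ l : List (ℕ × ℕ), (∀ t ∈ l, t.1 < k ∧ t.2 < k') ∧ l.length ≤ k * k' ∧
      M.length ≤ (l.foldl (phase G H c d us vs) []).length := by
  set S : Finset (ℕ × ℕ) := (M.map (cls c d)).toFinset with hS
  have hmemS : ∀ t, t ∈ S ↔ ∃ p ∈ M, cls c d p = t := by simp [hS]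
  set x : ℕ × ℕ → ℝ := fun t => (M.countP fun p => decide (cls c d p = t) : ℕ) with hx
  have hsum : ∀ P : ℕ × ℕ → Prop, ∀ [DecidablePred P],
      ∑ t ∈ S with P t, x t = (M.countP fun p => decide (P (cls c d p)) : ℕ) := by
    intro P _
    have := sum_countP_eq (M.map (cls c d)) P
    simp only [List.countP_map, Function.comp_def] at this
    rw [hx, ← Nat.cast_sum, this]
  have hgood : Good G H c d [] S := by
    refine ⟨List.Pairwise.nil, by simp, fun p q hp hq hpq h1 h2 => ?_⟩
    obtain ⟨p', hp', hpp⟩ := (hmemS _).1 hp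
    obtain ⟨q', hq', hqq⟩ := (hmemS _).1 hq
    refine compat_of_cls_eq hc hd (p := p') (q := q') (hM.forall hp' hq' ?_) h1 h2 hpp.symm hqq.symm
    rintro rfl
    exact hpq (hpp.symm.trans hqq)
  have hfeas : Transport.Feasible S (residual c (([] : List (V × W)).map Prod.fst))
      (residual d (([] : List (V × W)).map Prod.snd)) x := by
    refine ⟨fun t _ => Nat.cast_nonneg _, fun i => ?_, fun j => ?_⟩
    · have := countP_le_card c hM.nodup_fst i
      rw [List.countP_map] at this
      rw [hsum, residual, List.map_nil, List.countP_nil, Nat.cast_zero, sub_zero]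
      exact_mod_cast this
    · have := countP_le_card d hM.nodup_snd j
      rw [List.countP_map] at this
      rw [hsum, residual, List.map_nil, List.countP_nil, Nat.cast_zero, sub_zero]
      exact_mod_cast this
  -- Every cell of `S` contains a pair of `M`; two of them, being compatible, would make the cell
  -- unmixed.
  have hmixed : ∀ t ∈ S, Mixed G H c d t → x t = 1 := by
    rintro t ht ⟨p, q, hp, hq, h1, h2, hpq⟩
    obtain ⟨a, ha, hat⟩ := (hmemS t).1 ht
    have hpos : a ∈ M.filter fun p => decide (cls c d p = t) := by simp [ha, hat]
    have hval : Valid G H (M.filter fun p => decide (cls c d p = t)) := hM.filter _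
    have hall : ∀ b ∈ M.filter fun p => decide (cls c d p = t), cls c d b = t := by simp
    simp only [hx]
    rw [List.countP_eq_length_filter]
    match M.filter fun p => decide (cls c d p = t), hpos, hval, hall with
    | [_], _, _, _ => simp
    | a :: b :: _, _, hval, hall =>
      have hab : Compat G H a b := (List.pairwise_cons.1 hval).1 b (by simp)
      exact absurd (compat_of_cls_eq hc hd hab h1 h2 (by rw [hp, hall a (by simp)])
        (by rw [hq, hall b (by simp)])) hpq
  obtain ⟨l, h1, h2, h3⟩ := exists_phases hc hd hus hvs S [] x hgood hfeas hmixed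
  have hSsub : S ⊆ range k ×ˢ range k' := by
    intro t ht
    obtain ⟨p, -, rfl⟩ := (hmemS t).1 ht
    simp [cls, hk, hk']
  refine ⟨l, fun t ht => by simpa using hSsub (h1 t ht), h2.trans ?_, ?_⟩
  · simpa using card_le_card hSsub
  · have hall := hsum fun _ => True
    simp only [filter_true] at hall
    rw [hall] at h3
    simpa using h3

end Greedy

/-! ### The program -/

namespace LoopLang

open LoopLang.Expr LoopLang.Cmd

instance : Add Expr := ⟨Expr.add⟩
instance : Sub Expr := ⟨Expr.sub⟩

@[simp] theorem Expr.eval_add (x : List ℕ) (s : St) (e f : Expr) :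
    (e + f).eval x s = e.eval x s + f.eval x s := rfl

@[simp] theorem Expr.eval_sub (x : List ℕ) (s : St) (e f : Expr) :
    (e - f).eval x s = e.eval x s - f.eval x s := rfl

/-- An expression that is `0` if and only if the given one is not. -/
def Expr.not (e : Expr) : Expr := lit 1 - e

theorem Expr.eval_not_eq_zero (x : List ℕ) (s : St) (e : Expr) :
    e.not.eval x s = 0 ↔ e.eval x s ≠ 0 := by
  simp only [Expr.not, eval_sub, Expr.eval]; omega

theorem Expr.eval_add_eq_zero (x : List ℕ) (s : St) (e f : Expr) :
    (e + f).eval x s = 0 ↔ e.eval x s = 0 ∧ f.eval x s = 0 := by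
  simp

/-- A loop that adds up the values of an expression detects whether they are all `0`. -/
theorem eval_loop_sum_eq_zero (x : List ℕ) {i z b : ℕ} {e : Expr} (s : St) (F : ℕ → ℕ)
    (hbi : b ≠ i) (he : ∀ s' : St, (∀ j, j ≠ b → j ≠ i → s'.v j = s.v j) → s'.a = s.a →
      e.eval x s' = F (s'.v i)) :
    ((loop i z (set b (var b + e))).eval x s).v b = 0 ↔ s.v b = 0 ∧ ∀ j < s.v z, F j = 0 := by
  have h := inv_loop x (i := i) (z := z) (c := set b (var b + e)) (s := s)
    (R := fun l s' => (∀ j, j ≠ b → j ≠ i → s'.v j = s.v j) ∧ s'.a = s.a ∧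
      (s'.v b = 0 ↔ s.v b = 0 ∧ ∀ j < l, F j = 0))
    ⟨fun _ _ _ => rfl, rfl, by simp⟩ ?_
  · exact h.2.2
  · rintro l s' - ⟨h1, h2, h3⟩
    refine ⟨fun j hjb hji => ?_, h2, ?_⟩
    · rw [Cmd.eval, St.setV_v_of_ne _ _ hjb, St.setV_v_of_ne _ _ hji, h1 j hjb hji]
    · rw [Cmd.eval, St.setV_v_self, eval_add, he (s'.setV i l) (fun j hjb hji => by
        rw [St.setV_v_of_ne _ _ hji, h1 j hjb hji]) h2, Expr.eval, St.setV_v_of_ne _ _ hbi,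
        St.setV_v_self, add_eq_zero, h3, and_assoc, Nat.forall_lt_succ_right]

end LoopLang

namespace MCIS

open LoopLang LoopLang.Expr LoopLang.Cmd

/-! The variables and arrays; some of them exist for each of the two graphs. -/

abbrev vRes : ℕ := 0
abbrev vN (b : Bool) : ℕ := cond b 2 1
abbrev vRow : ℕ := 3
abbrev vNum (b : Bool) : ℕ := cond b 5 4
-- Holds K, the number of twin classes of both graphs together. Guesses are numbers with 2K² digits
-- in base K, and `vBound` holds how many there are.
abbrev vBase : ℕ := 6
abbrev vBound : ℕ := 7
abbrev vProd : ℕ := 8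
abbrev vU : ℕ := 9
abbrev vV : ℕ := 10
abbrev vT : ℕ := 11
abbrev vBad : ℕ := 12
abbrev vNew : ℕ := 13
abbrev vGuess : ℕ := 14
abbrev vQuot : ℕ := 15
abbrev vI : ℕ := 16
abbrev vJ : ℕ := 17
abbrev vLen : ℕ := 18
abbrev vG : ℕ := 19
abbrev vP : ℕ := 20
abbrev vP' : ℕ := 21
abbrev aRow (b : Bool) : Fin 8 := cond b 1 0
abbrev aCls (b : Bool) : Fin 8 := cond b 3 2
abbrev aFst : Fin 8 := 4
abbrev aSnd : Fin 8 := 5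

/-- Compute where the rows of an adjacency matrix start. -/
def rows (b : Bool) : Cmd :=
  loop vU (vN b) (.seq (put (aRow b) (var vU) (var vRow)) (set vRow (var vRow + var (vN b))))

/-- The adjacency bit of two vertices. -/
def bit (b : Bool) (e f : Expr) : Expr := inp (arr (aRow b) e + f)

/-- Does the vertex in `vT` show that those in `vU` and `vV` are not twins? -/
def separates (b : Bool) : Expr :=
  (((var vT).neq (var vU)).not + ((var vT).neq (var vV)).not +
    ((bit b (var vU) (var vT)).neq (bit b (var vV) (var vT))).not).not

/-- Set `vBad` to `0` if and only if the vertex in `vV` is a twin of the one in `vU` and comes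
before it. -/
def twinTest (b : Bool) : Cmd :=
  .seq (set vBad (var vU - var vV).not) (loop vT (vN b) (set vBad (var vBad + separates b)))

/-- Find the number of the twin class of the vertex in `vU`. -/
def classifyVertex (b : Bool) : Cmd :=
  .seq (set vNew (lit 1)) <|
  .seq (loop vV (vN b) (.seq (twinTest b)
    (ite (var vBad)
      (.seq (put (aCls b) (var vU) (arr (aCls b) (var vV))) (set vNew (lit 0))) skip))) <|
  ite (var vNew) skip
    (.seq (put (aCls b) (var vU) (var (vNum b))) (set (vNum b) (var (vNum b) + lit 1)))

/-- Number the twin classes. -/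
def classify (b : Bool) : Cmd := loop vU (vN b) (classifyVertex b)

/-- Multiply `vBound` by `vBase`. -/
def mulBase : Cmd :=
  .seq (set vProd (lit 0)) <|
  .seq (loop vT vBase (set vProd (var vProd + var vBound))) (set vBound (var vProd))

/-- Prepare the computation of the number of guesses. -/
def setBase : Cmd :=
  .seq (set vBase (var (vNum false) + var (vNum true))) (set vBound (lit 1))

/-- Compute the number of guesses. -/
def powers : Cmd := loop vP vBase (loop vP' vBase (.seq mulBase mulBase))

/-- Split the last digit off the guess. -/
def digit (d : ℕ) : Cmd :=
  .seq (set vQuot (lit 0)) <|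
  .seq (loop vT vBound (ite (var vBase - var vGuess)
    (.seq (set vGuess (var vGuess - var vBase)) (set vQuot (var vQuot + lit 1))) skip)) <|
  .seq (set d (var vGuess)) (set vGuess (var vQuot))

/-- Is the pair of vertices in `vU` and `vV` incompatible with the one at position `vT`? -/
def conflict : Expr :=
  ((var vLen - var vT).not +
    (((arr aFst (var vT)).neq (var vU)).not + ((arr aSnd (var vT)).neq (var vV)).not +
      (bit false (arr aFst (var vT)) (var vU)).neq
        (bit true (arr aSnd (var vT)) (var vV))).not).not

/-- Append the pair of vertices in `vU` and `vV` if that is possible. -/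
def tryAdd : Cmd :=
  .seq (set vBad ((arr (aCls false) (var vU)).neq (var vI) +
    (arr (aCls true) (var vV)).neq (var vJ))) <|
  .seq (loop vT (vN false) (set vBad (var vBad + conflict))) <|
  ite (var vBad) (.seq (put aFst (var vLen) (var vU)) <|
    .seq (put aSnd (var vLen) (var vV)) (set vLen (var vLen + lit 1))) skip

/-- Append as many pairs from the classes in `vI` and `vJ` as possible. -/
def phase : Cmd := loop vU (vN false) (loop vV (vN true) tryAdd)

/-- Run the phases that the guess prescribes. -/
def phases : Cmd :=
  loop vP vBase (loop vP' vBase (.seq (digit vI) (.seq (digit vJ) phase)))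

/-- Try all guesses. -/
def search : Cmd :=
  loop vG vBound <| .seq (set vGuess (var vG)) <| .seq (set vLen (lit 0)) <| .seq phases <|
    ite (inp (lit 2) - var vLen) (set vRes (lit 1)) skip

/-- Read the numbers of vertices. -/
def readSizes : Cmd :=
  .seq (set (vN false) (inp (lit 0))) (.seq (set (vN true) (inp (lit 1))) (set vRow (lit 3)))

/-- Find the rows of the adjacency matrices and the twin classes. -/
def prepare : Cmd :=
  .seq (rows false) (.seq (rows true) (.seq (classify false) (classify true)))

/-- The program that decides the problem. -/
def program : Cmd := .seq readSizes (.seq prepare (.seq setBase (.seq powers search)))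

end MCIS

/-! ### Correctness of the preprocessing: matrix rows and twin classes -/

namespace MCIS

open LoopLang LoopLang.Expr LoopLang.Cmd

theorem eval_rows (x : List ℕ) (b : Bool) (s : St) {n r : ℕ} (hn : s.v (vN b) = n)
    (hr : s.v vRow = r) :
    ((rows b).eval x s).v vRow = r + n * n ∧
      ∀ u < n, ((rows b).eval x s).a (aRow b) u = r + n * u := by
  have h := inv_loop x (i := vU) (z := vN b)
    (c := .seq (put (aRow b) (var vU) (var vRow)) (set vRow (var vRow + var (vN b)))) (s := s)
    (R := fun l s' => s'.v (vN b) = n ∧ s'.v vRow = r + n * l ∧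
      ∀ u < l, s'.a (aRow b) u = r + n * u)
    ⟨hn, by simpa using hr, by simp⟩ ?_
  · rw [hn] at h
    exact h.2
  · rintro l s' - ⟨h1, h2, h3⟩
    refine ⟨?_, ?_, fun u hu => ?_⟩
    · cases b <;> simpa [Cmd.eval, St.setV_v] using h1
    · have : (s'.setV vU l).v (vN b) = n := by cases b <;> simpa [St.setV_v] using h1
      simp only [Cmd.eval, St.setV_v_self, Expr.eval, St.setA_v, this]
      rw [St.setV_v_of_ne _ _ (by decide), h2]; ring
    · simp only [Cmd.eval, Expr.eval, St.setV_a, St.setV_v_self, St.setA_a, true_and]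
      split_ifs with hul
      · rw [St.setV_v_of_ne _ _ (by decide), h2, hul]
      · exact h3 u (by omega)

/-- The state holds the adjacency matrix of a graph. -/
def HasGraph (x : List ℕ) (b : Bool) {n : ℕ} (G : SimpleGraph (Fin n)) (s : St) : Prop :=
  s.v (vN b) = n ∧ ∀ u w : Fin n, (x.getD (s.a (aRow b) u + w) 0 = 1 ∧ G.Adj u w) ∨
    (x.getD (s.a (aRow b) u + w) 0 = 0 ∧ ¬ G.Adj u w)

theorem HasGraph.congr {x : List ℕ} {b : Bool} {n : ℕ} {G : SimpleGraph (Fin n)} {s s' : St}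
    (h : HasGraph x b G s) (hv : s'.v (vN b) = s.v (vN b)) (ha : s'.a (aRow b) = s.a (aRow b)) :
    HasGraph x b G s' := ⟨hv.trans h.1, by rw [ha]; exact h.2⟩

theorem HasGraph.eval {x : List ℕ} {b : Bool} {n : ℕ} {G : SimpleGraph (Fin n)} {s : St}
    (h : HasGraph x b G s) (c : Cmd) (hv : c.WritesV (vN b) = false)
    (ha : c.WritesA (aRow b) = false) : HasGraph x b G (c.eval x s) :=
  h.congr (eval_v_of_not_writesV x c s hv) (eval_a_of_not_writesA x c s ha)

section Classify

variable {x : List ℕ} {b : Bool} {n : ℕ} {G : SimpleGraph (Fin n)}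

/-- The initial value 1 - (u - w) vanishes exactly when w < u; each separating vertex then adds 1.
-/
theorem eval_twinTest {s : St} (hG : HasGraph x b G s) (u w : Fin n) (hu : s.v vU = u)
    (hw : s.v vV = w) : ((twinTest b).eval x s).v vBad = 0 ↔ w < u ∧ G.Twins w u := by
  rw [twinTest, Cmd.eval, eval_loop_sum_eq_zero x _ (fun z => if z ≠ u ∧ z ≠ w ∧
    x.getD (s.a (aRow b) u + z) 0 ≠ x.getD (s.a (aRow b) w + z) 0 then 1 else 0) (by decide)]
  · have h1 : ((set vBad (var vU - var vV).not).eval x s).v vBad = 0 ↔ w < u := by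
      rw [Cmd.eval, St.setV_v_self, eval_not_eq_zero, eval_sub, Expr.eval, Expr.eval, hu, hw,
        Fin.lt_def]
      omega
    have h2 : ((set vBad (var vU - var vV).not).eval x s).v (vN b) = n := by
      rw [eval_v_of_not_writesV _ _ _ (by cases b <;> rfl), hG.1]
    rw [h1, h2, SimpleGraph.twins_iff]
    refine and_congr_right fun _ => ⟨fun h z hzw hzu => ?_, fun h z hz => ?_⟩
    · have hz := h z z.2
      simp only [ne_eq, Fin.val_eq_val, hzu, hzw, not_false_eq_true, true_and] at hz
      have hz' : x.getD (s.a (aRow b) u + z) 0 = x.getD (s.a (aRow b) w + z) 0 := by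
        by_contra hne
        rw [if_pos hne] at hz
        exact one_ne_zero hz
      rcases hG.2 u z with ⟨h1, h2⟩ | ⟨h1, h2⟩ <;> rcases hG.2 w z with ⟨h3, h4⟩ | ⟨h3, h4⟩ <;>
        first
        | exact iff_of_true h4 h2
        | exact iff_of_false h4 h2
        | (rw [h1, h3] at hz'; omega)
    · rw [if_neg]
      rintro ⟨hzu, hzw, hne⟩
      have := h ⟨z, hz⟩ (fun h => hzw (congrArg Fin.val h)) (fun h => hzu (congrArg Fin.val h))
      rcases hG.2 u ⟨z, hz⟩ with ⟨h1, h2⟩ | ⟨h1, h2⟩ <;>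
        rcases hG.2 w ⟨z, hz⟩ with ⟨h3, h4⟩ | ⟨h3, h4⟩
      · exact hne (h1.trans h3.symm)
      · exact h4 (this.2 h2)
      · exact h2 (this.1 h4)
      · exact hne (h1.trans h3.symm)
  · intro s' hv ha
    have hu' : s'.v vU = u := by
      rw [hv _ (by decide) (by decide), eval_v_of_not_writesV _ _ _ rfl, hu]
    have hw' : s'.v vV = w := by
      rw [hv _ (by decide) (by decide), eval_v_of_not_writesV _ _ _ rfl, hw]
    have ha' : s'.a = s.a := ha
    have h0 : (separates b).eval x s' = 0 ↔ ¬ (s'.v vT ≠ u ∧ s'.v vT ≠ w ∧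
        x.getD (s.a (aRow b) u + s'.v vT) 0 ≠ x.getD (s.a (aRow b) w + s'.v vT) 0) := by
      rw [separates, eval_not_eq_zero, ne_eq, not_iff_not, eval_add_eq_zero, eval_add_eq_zero,
        eval_not_eq_zero, eval_not_eq_zero, eval_not_eq_zero, ne_eq, ne_eq, ne_eq,
        eval_neq_eq_zero, eval_neq_eq_zero, eval_neq_eq_zero, and_assoc]
      simp only [bit, Expr.eval, hu', hw', ha', ne_eq]
    have h1 : (separates b).eval x s' ≤ 1 := by
      rw [separates, Expr.not, eval_sub, Expr.eval]; omega
    split_ifs with h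
    · have := mt h0.1 (not_not.2 h); omega
    · exact h0.2 h

/-- The twin classes of the vertices before `j` have been numbered. -/
structure Classified (x : List ℕ) (b : Bool) (G : SimpleGraph (Fin n)) (j : ℕ) (s : St) :
    Prop where
  graph : HasGraph x b G s
  lt : ∀ u : Fin n, u < j → s.a (aCls b) u < s.v (vNum b)
  iff : ∀ u w : Fin n, u < j → w < j → (s.a (aCls b) u = s.a (aCls b) w ↔ G.Twins u w)
  surj : ∀ i < s.v (vNum b), ∃ u : Fin n, u < j ∧ s.a (aCls b) u = i

/-- If there are several earlier twins, the last one determines the entry of `u`. Values are copied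
only from positions other than `u`, which still hold their original contents. -/
theorem eval_searchTwin {s : St} (hG : HasGraph x b G s) (u : Fin n) (hu : s.v vU = u)
    (hnew : s.v vNew = 1) :
    let s' := (loop vV (vN b) (.seq (twinTest b) (ite (var vBad)
      (.seq (put (aCls b) (var vU) (arr (aCls b) (var vV))) (set vNew (lit 0))) skip))).eval x s
    (∀ i, i ≠ (u : ℕ) → s'.a (aCls b) i = s.a (aCls b) i) ∧
      (s'.v vNew ≠ 0 → ∀ w < u, ¬ G.Twins w u) ∧
      (s'.v vNew = 0 → ∃ w < u, G.Twins w u ∧ s'.a (aCls b) u = s.a (aCls b) w) := by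
  intro s'
  have h := inv_loop x (i := vV) (z := vN b) (c := .seq (twinTest b) (ite (var vBad)
      (.seq (put (aCls b) (var vU) (arr (aCls b) (var vV))) (set vNew (lit 0))) skip)) (s := s)
    (R := fun l s' => HasGraph x b G s' ∧ s'.v vU = u ∧
      (∀ i, i ≠ (u : ℕ) → s'.a (aCls b) i = s.a (aCls b) i) ∧
      (s'.v vNew ≠ 0 → ∀ w < u, w < l → ¬ G.Twins w u) ∧
      (s'.v vNew = 0 → ∃ w < u, G.Twins w u ∧ s'.a (aCls b) u = s.a (aCls b) w))
    ⟨hG, hu, fun _ _ => rfl, by simp, by simp [hnew]⟩ ?_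
  · obtain ⟨-, -, h1, h2, h3⟩ := h
    exact ⟨h1, fun h w hw => h2 h w hw (hG.1 ▸ w.2), h3⟩
  · rintro l t hl ⟨h1, h2, h3, h4, h5⟩
    rw [hG.1] at hl
    set t₁ := t.setV vV l with ht₁
    have hG₁ : HasGraph x b G t₁ :=
      h1.congr (by cases b <;> rfl) rfl
    have hu₁ : t₁.v vU = u := by rw [ht₁, St.setV_v_of_ne _ _ (by decide), h2]
    have htw := eval_twinTest hG₁ u ⟨l, hl⟩ hu₁ (by simp [ht₁])
    set t₂ := (twinTest b).eval x t₁ with ht₂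
    have hG₂ : HasGraph x b G t₂ := hG₁.eval _ (by cases b <;> rfl) (by cases b <;> rfl)
    have hu₂ : t₂.v vU = u := by
      rw [ht₂, eval_v_of_not_writesV _ _ _ (by cases b <;> rfl), hu₁]
    have hv₂ : t₂.v vV = l := by
      rw [ht₂, eval_v_of_not_writesV _ _ _ (by cases b <;> rfl)]; simp [ht₁]
    have hn₂ : t₂.v vNew = t.v vNew := by
      rw [ht₂, eval_v_of_not_writesV _ _ _ (by cases b <;> rfl), ht₁,
        St.setV_v_of_ne _ _ (by decide)]
    have ha₂ : t₂.a (aCls b) = t.a (aCls b) := by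
      rw [ht₂, eval_a_of_not_writesA _ _ _ (by cases b <;> rfl)]; rfl
    rw [Cmd.eval, ← ht₂, Cmd.eval, Expr.eval]
    split_ifs with hbad
    · obtain ⟨hlu, htwin⟩ := htw.1 hbad
      have hne : l ≠ (u : ℕ) := fun h => absurd hlu (by simp [h])
      simp only [Cmd.eval, Expr.eval, hu₂, hv₂]
      refine ⟨hG₂.congr (by cases b <;> rfl) (by cases b <;> rfl), ?_, fun i hi => ?_, ?_, ?_⟩
      · rw [St.setV_v_of_ne _ _ (by decide), St.setA_v, hu₂]
      · rw [St.setV_a, St.setA_a, if_neg (by simp [hi]), ha₂, h3 i hi]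
      · simp
      · intro _
        refine ⟨_, hlu, htwin, ?_⟩
        rw [St.setV_a, St.setA_a, if_pos ⟨rfl, rfl⟩, ha₂, h3 l hne]
    · refine ⟨hG₂, hu₂, by rw [Cmd.eval, ha₂]; exact h3, ?_, ?_⟩
      · rw [Cmd.eval, hn₂]
        intro hnew w hwu hwl
        rcases Nat.lt_succ_iff_lt_or_eq.1 hwl with hwl | hwl
        · exact h4 hnew w hwu hwl
        · have : w = ⟨l, hl⟩ := Fin.ext hwl
          subst this
          exact fun h => hbad (htw.2 ⟨hwu, h⟩)
      · rw [Cmd.eval, hn₂, ha₂]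
        exact h5

theorem eval_classifyVertex {s : St} {j : ℕ} (hj : j < n) (h : Classified x b G j s) :
    Classified x b G (j + 1) ((classifyVertex b).eval x (s.setV vU j)) := by
  set u : Fin n := ⟨j, hj⟩ with hu
  set s₁ := (set vNew (lit 1)).eval x (s.setV vU j) with hs₁
  have hG₁ : HasGraph x b G s₁ := h.graph.congr (by cases b <;> rfl) rfl
  have hu₁ : s₁.v vU = u := by
    rw [hs₁, Cmd.eval, St.setV_v_of_ne _ _ (by decide), St.setV_v_self]
  have key := eval_searchTwin hG₁ u hu₁ (by rw [hs₁, Cmd.eval, St.setV_v_self, Expr.eval])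
  have hk₁ : s₁.v (vNum b) = s.v (vNum b) := by cases b <;> rfl
  have ha₁ : s₁.a = s.a := rfl
  rw [classifyVertex, Cmd.eval, ← hs₁, Cmd.eval]
  generalize hloop : (loop vV (vN b) (.seq (twinTest b) (ite (var vBad)
      (.seq (put (aCls b) (var vU) (arr (aCls b) (var vV))) (set vNew (lit 0))) skip))) = c at key
  set s₂ := c.eval x s₁ with hs₂
  have hG₂ : HasGraph x b G s₂ :=
    hG₁.eval _ (by rw [← hloop]; cases b <;> rfl) (by rw [← hloop]; cases b <;> rfl)
  have hu₂ : s₂.v vU = u := by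
    rw [hs₂, eval_v_of_not_writesV _ _ _ (by rw [← hloop]; cases b <;> rfl), hu₁]
  have hk₂ : s₂.v (vNum b) = s.v (vNum b) := by
    rw [hs₂, eval_v_of_not_writesV _ _ _ (by rw [← hloop]; cases b <;> rfl), hk₁]
  obtain ⟨h1, h2, h3⟩ := key
  rw [ha₁] at h1 h3
  have hold : ∀ w : Fin n, (w : ℕ) < j → s₂.a (aCls b) w = s.a (aCls b) w :=
    fun w hw => h1 w (by simp [hu]; omega)
  have hcase : ∀ w : Fin n, (w : ℕ) < j + 1 → (w : ℕ) < j ∨ w = u := fun w hw => by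
    rcases Nat.lt_succ_iff_lt_or_eq.1 hw with hw | hw
    · exact Or.inl hw
    · exact Or.inr (Fin.ext hw)
  have htsymm := G.twins_equivalence
  rw [Cmd.eval, Expr.eval]
  split_ifs with hnew
  · obtain ⟨w, hwu, htw, hcw⟩ := h3 hnew
    have hwj : (w : ℕ) < j := hwu
    rw [Cmd.eval]
    refine ⟨hG₂, fun a ha => ?_, fun a a' ha ha' => ?_, fun i hi => ?_⟩
    · rw [hk₂]
      rcases hcase a ha with ha | rfl
      · rw [hold a ha]; exact h.lt a ha
      · rw [hcw]; exact h.lt w hwj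
    · have hrep : ∀ a : Fin n, (a : ℕ) < j + 1 → ∃ a' : Fin n, (a' : ℕ) < j ∧ G.Twins a' a ∧
          s₂.a (aCls b) a = s.a (aCls b) a' := by
        intro a ha
        rcases hcase a ha with ha | rfl
        · exact ⟨a, ha, htsymm.refl a, hold a ha⟩
        · exact ⟨w, hwj, htw, hcw⟩
      obtain ⟨c₁, hc₁, ht₁, he₁⟩ := hrep a ha
      obtain ⟨c₂, hc₂, ht₂, he₂⟩ := hrep a' ha'
      rw [he₁, he₂, h.iff c₁ c₂ hc₁ hc₂]
      exact ⟨fun h => htsymm.trans (htsymm.symm ht₁) (htsymm.trans h ht₂),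
        fun h => htsymm.trans ht₁ (htsymm.trans h (htsymm.symm ht₂))⟩
    · rw [hk₂] at hi
      obtain ⟨a, ha, hai⟩ := h.surj i hi
      exact ⟨a, by omega, by rw [hold a ha, hai]⟩
  · have hnt := h2 hnew
    simp only [Cmd.eval, Expr.eval, hu₂, hk₂, St.setA_v]
    have hcu : ((s₂.setA (aCls b) u (s.v (vNum b))).setV (vNum b) (s.v (vNum b) + 1)).a (aCls b) u
        = s.v (vNum b) := by rw [St.setV_a, St.setA_a, if_pos ⟨rfl, rfl⟩]
    have hcw : ∀ w : Fin n, (w : ℕ) < j →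
        ((s₂.setA (aCls b) u (s.v (vNum b))).setV (vNum b) (s.v (vNum b) + 1)).a (aCls b) w
          = s.a (aCls b) w := fun w hw => by
      rw [St.setV_a, St.setA_a, if_neg (by simp [hu]; omega), hold w hw]
    refine ⟨hG₂.congr (by cases b <;> rfl) (by cases b <;> rfl), fun a ha => ?_,
      fun a a' ha ha' => ?_, fun i hi => ?_⟩
    · rw [St.setV_v_self]
      rcases hcase a ha with ha | rfl
      · rw [hcw a ha]; exact (h.lt a ha).trans (Nat.lt_succ_self _)
      · rw [hcu]; exact Nat.lt_succ_self _
    · rcases hcase a ha with ha | rfl <;> rcases hcase a' ha' with ha' | rfl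
      · rw [hcw a ha, hcw a' ha', h.iff a a' ha ha']
      · rw [hcw a ha, hcu]
        exact iff_of_false (h.lt a ha).ne (hnt a ha)
      · rw [hcw a' ha', hcu]
        exact iff_of_false (h.lt a' ha').ne' fun ht => hnt a' ha' (htsymm.symm ht)
      · exact iff_of_true rfl (htsymm.refl _)
    · rw [St.setV_v_self] at hi
      rcases Nat.lt_succ_iff_lt_or_eq.1 hi with hi | rfl
      · obtain ⟨a, ha, hai⟩ := h.surj i hi
        exact ⟨a, by omega, by rw [hcw a ha, hai]⟩
      · exact ⟨u, Nat.lt_succ_self _, hcu⟩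

theorem eval_classify {s : St} (hG : HasGraph x b G s) (h0 : s.v (vNum b) = 0) :
    Classified x b G n ((classify b).eval x s) := by
  have h := inv_loop x (i := vU) (z := vN b) (c := classifyVertex b) (s := s)
    (R := fun l s' => Classified x b G l s')
    ⟨hG, by simp, by simp, by simp [h0]⟩
    fun j s' hj h => eval_classifyVertex (by rwa [hG.1] at hj) h
  rwa [hG.1] at h

/-- Vertices with different numbers are not twins, so one vertex for each number gives an injection
into the twin classes. This bounds the running time by the parameter. -/
theorem Classified.num_le_nd {s : St} (h : Classified x b G n s) : s.v (vNum b) ≤ G.nd := by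
  choose f hf using fun i : Fin (s.v (vNum b)) => h.surj i i.2
  have hinj : Function.Injective fun i => (Quotient.mk G.twinSetoid (f i)) := by
    intro i i' hii
    have ht : G.Twins (f i) (f i') := Quotient.exact hii
    have := (h.iff _ _ (f i).2 (f i').2).2 ht
    rw [(hf i).2, (hf i').2] at this
    exact Fin.ext this
  have := Nat.card_le_card_of_injective _ hinj
  rwa [Nat.card_eq_fintype_card, Fintype.card_fin] at this

end Classify

end MCIS

/-! ### Correctness of the arithmetic: the number of guesses and their digits -/

namespace MCIS

open LoopLang LoopLang.Expr LoopLang.Cmd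

theorem eval_mulBase (x : List ℕ) (s : St) :
    (mulBase.eval x s).v vBound = s.v vBound * s.v vBase := by
  set s₁ := (set vProd (lit 0)).eval x s with hs₁
  have hK₁ : s₁.v vBase = s.v vBase := rfl
  have h := inv_loop x (i := vT) (z := vBase) (c := set vProd (var vProd + var vBound)) (s := s₁)
    (R := fun l s' => s'.v vBound = s.v vBound ∧ s'.v vProd = s.v vBound * l)
    ⟨rfl, rfl⟩ ?_
  · have hev : mulBase.eval x s = (set vBound (var vProd)).eval x
      ((loop vT vBase (set vProd (var vProd + var vBound))).eval x s₁) := rfl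
    rw [hev, Cmd.eval, St.setV_v_self, Expr.eval, h.2, hK₁]
  · rintro l s' - ⟨h1, h2⟩
    refine ⟨h1, ?_⟩
    rw [Cmd.eval, St.setV_v_self, eval_add, Expr.eval, Expr.eval, St.setV_v_of_ne _ _ (by decide),
      St.setV_v_of_ne _ _ (by decide), h1, h2, Nat.mul_succ]

/-- One factor K for each digit: two digits for each of K² phases. For K = 0 no round takes place
and the result is 1 = 0 ^ 0. -/
theorem eval_powers (x : List ℕ) (s : St) (h : s.v vBound = 1) :
    (powers.eval x s).v vBound = s.v vBase ^ (2 * (s.v vBase * s.v vBase)) := by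
  have key : ∀ s' : St, s'.v vBase = s.v vBase →
      ((loop vP' vBase (.seq mulBase mulBase)).eval x s').v vBound =
        s'.v vBound * s.v vBase ^ (2 * s.v vBase) := by
    intro s₀ hs₀
    have h := inv_loop x (i := vP') (z := vBase) (c := .seq mulBase mulBase) (s := s₀)
      (R := fun l s' => s'.v vBase = s.v vBase ∧
        s'.v vBound = s₀.v vBound * s.v vBase ^ (2 * l))
      ⟨hs₀, by simp⟩ ?_
    · rw [h.2, hs₀]
    · rintro l s' - ⟨h1, h2⟩
      have h1' : (s'.setV vP' l).v vBase = s.v vBase := h1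
      have h2' : (s'.setV vP' l).v vBound = s₀.v vBound * s.v vBase ^ (2 * l) := h2
      refine ⟨(eval_v_of_not_writesV _ _ _ rfl).trans h1', ?_⟩
      rw [Cmd.eval, eval_mulBase, eval_mulBase, eval_v_of_not_writesV _ _ _ rfl, h1', h2',
        mul_add, mul_one, pow_add, pow_two]
      ring
  have h := inv_loop x (i := vP) (z := vBase) (c := loop vP' vBase (.seq mulBase mulBase)) (s := s)
    (R := fun l s' => s'.v vBase = s.v vBase ∧
      s'.v vBound = s.v vBase ^ (2 * (s.v vBase * l)))
    ⟨rfl, by simpa using h⟩ ?_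
  · exact h.2
  · rintro l s' - ⟨h1, h2⟩
    refine ⟨(eval_v_of_not_writesV _ _ _ rfl).trans h1, ?_⟩
    rw [key (s'.setV vP l) h1, show (s'.setV vP l).v vBound = s'.v vBound from rfl, h2, ← pow_add]
    congr 1
    ring

theorem eval_digit (x : List ℕ) (d : ℕ) (s : St) (hd : d ≠ vGuess) (hK : 0 < s.v vBase)
    (hd' : d ≠ vQuot) (hg : s.v vGuess ≤ s.v vBound) :
    ((digit d).eval x s).v vGuess = s.v vGuess / s.v vBase ∧
      ((digit d).eval x s).v d = s.v vGuess % s.v vBase := by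
  set K := s.v vBase with hKdef
  set g := s.v vGuess with hgdef
  set c : Cmd := ite (var vBase - var vGuess)
    (.seq (set vGuess (var vGuess - var vBase)) (set vQuot (var vQuot + lit 1))) skip with hc
  set s₁ := (set vQuot (lit 0)).eval x s with hs₁
  have h := inv_loop x (i := vT) (z := vBound) (c := c) (s := s₁)
    (R := fun l s' => s'.v vBase = K ∧ s'.v vGuess + K * s'.v vQuot = g ∧
      (s'.v vGuess < K ∨ l ≤ s'.v vQuot))
    ⟨rfl, by simp [hs₁, Cmd.eval, St.setV_v, ← hgdef], by simp⟩ ?_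
  · set s₂ := (loop vT vBound c).eval x s₁ with hs₂
    obtain ⟨-, h2, h3⟩ := h
    have hB : s₁.v vBound = s.v vBound := rfl
    rw [hB] at h3
    -- If every round subtracted, the quotient is at least `vBound`, hence at least `g`, and `g` is
    -- the remainder plus K times the quotient; so the remainder is 0.
    have h3' : s₂.v vGuess < K := by
      rcases h3 with h3 | h3
      · exact h3
      · have : s₂.v vQuot ≤ K * s₂.v vQuot := Nat.le_mul_of_pos_left _ hK
        omega
    have hdiv : g / K = s₂.v vQuot := by
      rw [← h2, Nat.add_mul_div_left _ _ hK, Nat.div_eq_of_lt h3', zero_add]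
    have hmod : g % K = s₂.v vGuess := by
      rw [← h2, Nat.add_mul_mod_self_left, Nat.mod_eq_of_lt h3']
    have hev : (digit d).eval x s = (s₂.setV d (s₂.v vGuess)).setV vGuess
      ((s₂.setV d (s₂.v vGuess)).v vQuot) := rfl
    rw [hev, hdiv, hmod, St.setV_v_self, St.setV_v_of_ne _ _ hd'.symm, St.setV_v_of_ne _ _ hd,
      St.setV_v_self]
    exact ⟨rfl, rfl⟩
  · rintro l s' - ⟨h1, h2, h3⟩
    have e1 : (s'.setV vT l).v vBase = K := h1
    have e2 : (s'.setV vT l).v vGuess = s'.v vGuess := rfl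
    have e3 : (s'.setV vT l).v vQuot = s'.v vQuot := rfl
    rw [hc, Cmd.eval, eval_sub, Expr.eval, Expr.eval, e1, e2]
    split_ifs with hle
    · have f1 : ((Cmd.seq (set vGuess (var vGuess - var vBase))
          (set vQuot (var vQuot + lit 1))).eval x (s'.setV vT l)).v vGuess = s'.v vGuess - K := by
        rw [← h1]; rfl
      have f2 : ((Cmd.seq (set vGuess (var vGuess - var vBase))
          (set vQuot (var vQuot + lit 1))).eval x (s'.setV vT l)).v vQuot = s'.v vQuot + 1 := rfl
      refine ⟨h1, ?_, ?_⟩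
      · rw [f1, f2, mul_add, mul_one]; omega
      · rw [f1, f2]; omega
    · rw [Cmd.eval]
      refine ⟨h1, h2, Or.inl ?_⟩
      rw [e2]; omega

/-! ### Correctness of the phases and of the search -/

section Greedy

variable {n m : ℕ}

/-- What the main part of the program presupposes. -/
structure Ctx (x : List ℕ) (G : SimpleGraph (Fin n)) (H : SimpleGraph (Fin m)) (c : Fin n → ℕ)
    (d : Fin m → ℕ) (K B : ℕ) (s : St) : Prop where
  graph₁ : HasGraph x false G s
  graph₂ : HasGraph x true H s
  cls₁ : ∀ u : Fin n, s.a (aCls false) u = c u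
  cls₂ : ∀ v : Fin m, s.a (aCls true) v = d v
  base : s.v vBase = K
  bound : s.v vBound = B

/-- The list `L` is stored in the state. -/
structure Holds (L : List (Fin n × Fin m)) (s : St) : Prop where
  len : s.v vLen = L.length
  fst : ∀ (t : ℕ) (h : t < L.length), s.a aFst t = (L[t].1 : ℕ)
  snd : ∀ (t : ℕ) (h : t < L.length), s.a aSnd t = (L[t].2 : ℕ)

variable {x : List ℕ} {G : SimpleGraph (Fin n)} {H : SimpleGraph (Fin m)} {c : Fin n → ℕ}
  {d : Fin m → ℕ} {K B : ℕ}

theorem Ctx.congr {s s' : St} (h : Ctx x G H c d K B s) (hv : ∀ i ∈ [1, 2, 6, 7], s'.v i = s.v i)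
    (ha : ∀ k ∈ [0, 1, 2, 3], s'.a k = s.a k) : Ctx x G H c d K B s' where
  graph₁ := h.graph₁.congr (hv _ (by decide)) (ha _ (by decide))
  graph₂ := h.graph₂.congr (hv _ (by decide)) (ha _ (by decide))
  cls₁ u := by rw [ha _ (by decide), h.cls₁]
  cls₂ u := by rw [ha _ (by decide), h.cls₂]
  base := by rw [hv _ (by decide), h.base]
  bound := by rw [hv _ (by decide), h.bound]

theorem Ctx.eval {s : St} (h : Ctx x G H c d K B s) (C : Cmd)
    (hv : ∀ i ∈ [1, 2, 6, 7], C.WritesV i = false) (ha : ∀ k ∈ [0, 1, 2, 3], C.WritesA k = false) :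
    Ctx x G H c d K B (C.eval x s) :=
  h.congr (fun i hi => eval_v_of_not_writesV x C s (hv i hi))
    fun k hk => eval_a_of_not_writesA x C s (ha k hk)

theorem Holds.congr {L : List (Fin n × Fin m)} {s s' : St} (h : Holds L s)
    (hv : s'.v vLen = s.v vLen) (h4 : s'.a aFst = s.a aFst) (h5 : s'.a aSnd = s.a aSnd) :
    Holds L s' where
  len := by rw [hv, h.len]
  fst := by rw [h4]; exact h.fst
  snd := by rw [h5]; exact h.snd

/-- First coordinates of a valid list are distinct, so the list has at most n entries and n rounds
inspect all of it. Stale cells beyond its end are masked by the comparison with `vLen`. -/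
theorem eval_conflictLoop {s : St} {L : List (Fin n × Fin m)} (hC : Ctx x G H c d K B s)
    (hL : Holds L s) (hval : Greedy.Valid G H L) (q : Fin n × Fin m) (hu : s.v vU = q.1)
    (hv : s.v vV = q.2) :
    ((loop vT (vN false) (set vBad (var vBad + conflict))).eval x s).v vBad = 0 ↔
      s.v vBad = 0 ∧ ∀ p ∈ L, Greedy.Compat G H p q := by
  classical
  rw [eval_loop_sum_eq_zero x _ (fun t => if h : t < L.length then
    if Greedy.Compat G H L[t] q then 0 else 1 else 0) (by decide)]
  · refine and_congr_right fun _ => ?_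
    have hlen : L.length ≤ s.v (vN false) := by
      have := hval.nodup_fst.length_le_card
      rw [hC.graph₁.1]
      simpa using this
    constructor
    · intro h p hp
      obtain ⟨t, ht, rfl⟩ := List.getElem_of_mem hp
      have := h t (ht.trans_le hlen)
      rw [dif_pos ht] at this
      by_contra hne
      rw [if_neg hne] at this
      exact one_ne_zero this
    · intro h t _
      split_ifs with h1 h2
      · rfl
      · exact absurd (h _ (List.getElem_mem h1)) h2
      · rfl
  · intro s' hv' ha'
    have hu₁ : s'.v vU = q.1 := by rw [hv' _ (by decide) (by decide), hu]
    have hv₁ : s'.v vV = q.2 := by rw [hv' _ (by decide) (by decide), hv]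
    have hl₁ : s'.v vLen = L.length := by rw [hv' _ (by decide) (by decide), hL.len]
    have h0 : conflict.eval x s' = 0 ↔ ¬ (s'.v vT < L.length ∧
        ¬ (s.a aFst (s'.v vT) ≠ q.1 ∧ s.a aSnd (s'.v vT) ≠ q.2 ∧
        x.getD (s.a (aRow false) (s.a aFst (s'.v vT)) + q.1) 0 =
          x.getD (s.a (aRow true) (s.a aSnd (s'.v vT)) + q.2) 0)) := by
      rw [conflict, eval_not_eq_zero, ne_eq, not_iff_not, eval_add_eq_zero, eval_not_eq_zero,
        eval_not_eq_zero, eval_sub]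
      refine and_congr ?_ (not_congr ?_)
      · rw [Expr.eval, Expr.eval, hl₁]; omega
      · rw [eval_add_eq_zero, eval_add_eq_zero, eval_not_eq_zero, eval_not_eq_zero, ne_eq, ne_eq,
          eval_neq_eq_zero, eval_neq_eq_zero, eval_neq_eq_zero, and_assoc]
        simp only [bit, Expr.eval, hu₁, hv₁, ha', ne_eq]
    have h1 : conflict.eval x s' ≤ 1 := by
      rw [conflict, Expr.not, eval_sub, Expr.eval]; omega
    by_cases ht : s'.v vT < L.length
    · rw [dif_pos ht]
      have hcompat : Greedy.Compat G H L[s'.v vT] q ↔ s.a aFst (s'.v vT) ≠ q.1 ∧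
          s.a aSnd (s'.v vT) ≠ q.2 ∧ x.getD (s.a (aRow false) (s.a aFst (s'.v vT)) + q.1) 0 =
          x.getD (s.a (aRow true) (s.a aSnd (s'.v vT)) + q.2) 0 := by
        rw [hL.fst _ ht, hL.snd _ ht]
        refine and_congr (not_congr Fin.ext_iff) (and_congr (not_congr Fin.ext_iff) ?_)
        rcases hC.graph₁.2 L[s'.v vT].1 q.1 with ⟨e1, a1⟩ | ⟨e1, a1⟩ <;>
          rcases hC.graph₂.2 L[s'.v vT].2 q.2 with ⟨e2, a2⟩ | ⟨e2, a2⟩ <;>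
          rw [e1, e2] <;> simp [a1, a2]
      rw [← hcompat] at h0
      split_ifs with hcm
      · exact h0.2 fun h => h.2 hcm
      · have := mt h0.1 (not_not.2 ⟨ht, hcm⟩)
        omega
    · rw [dif_neg ht]
      exact h0.2 fun h => ht h.1

/-- The invariant of a phase. -/
structure InPhase (x : List ℕ) (G : SimpleGraph (Fin n)) (H : SimpleGraph (Fin m))
    (c : Fin n → ℕ) (d : Fin m → ℕ) (K B : ℕ) (t : ℕ × ℕ) (s : St) (L : List (Fin n × Fin m)) :
    Prop where
  ctx : Ctx x G H c d K B s
  i : s.v vI = t.1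
  j : s.v vJ = t.2
  holds : Holds L s
  valid : Greedy.Valid G H L

theorem InPhase.congr {t : ℕ × ℕ} {s s' : St} {L : List (Fin n × Fin m)}
    (h : InPhase x G H c d K B t s L)
    (hv : ∀ i ∈ [1, 2, 6, 7, 16, 17, 18], s'.v i = s.v i) (ha : s'.a = s.a) :
    InPhase x G H c d K B t s' L where
  ctx := h.ctx.congr (fun i hi => hv i (by revert i; decide)) fun k _ => by rw [ha]
  i := by rw [hv _ (by decide), h.i]
  j := by rw [hv _ (by decide), h.j]
  holds := h.holds.congr (hv _ (by decide)) (by rw [ha]) (by rw [ha])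
  valid := h.valid

theorem InPhase.setV {t : ℕ × ℕ} {s : St} {L : List (Fin n × Fin m)}
    (h : InPhase x G H c d K B t s L) {i : ℕ} (k : ℕ) (hi : i ∉ [1, 2, 6, 7, 16, 17, 18]) :
    InPhase x G H c d K B t (s.setV i k) L :=
  h.congr (fun _ hj => St.setV_v_of_ne _ _ fun he => hi (he ▸ hj)) rfl

theorem eval_tryAdd {t : ℕ × ℕ} {s : St} {L : List (Fin n × Fin m)}
    (h : InPhase x G H c d K B t s L) (q : Fin n × Fin m) (hu : s.v vU = q.1)
    (hv : s.v vV = q.2) :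
    InPhase x G H c d K B t (tryAdd.eval x s) (Greedy.tryAdd G H c d t L q) := by
  set e := (arr (aCls false) (var vU)).neq (var vI) + (arr (aCls true) (var vV)).neq (var vJ)
    with he
  set s₁ := s.setV vBad (e.eval x s) with hs₁
  have h₁ : InPhase x G H c d K B t s₁ L := h.setV _ (by decide)
  have hu₁ : s₁.v vU = q.1 := by rw [hs₁, St.setV_v_of_ne _ _ (by decide), hu]
  have hv₁ : s₁.v vV = q.2 := by rw [hs₁, St.setV_v_of_ne _ _ (by decide), hv]
  have hbad := eval_conflictLoop h₁.ctx h₁.holds h.valid q hu₁ hv₁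
  have hb₁ : s₁.v vBad = 0 ↔ Greedy.cls c d q = t := by
    rw [hs₁, St.setV_v_self, he, eval_add_eq_zero, eval_neq_eq_zero, eval_neq_eq_zero]
    simp only [Expr.eval, hu, hv, h.i, h.j, h.ctx.cls₁, h.ctx.cls₂]
    rw [Greedy.cls, Prod.ext_iff]
  rw [hb₁] at hbad
  set s₂ := (loop vT (vN false) (set vBad (var vBad + conflict))).eval x s₁ with hs₂
  have ha₂ : s₂.a = s₁.a := by
    funext k
    exact eval_a_of_not_writesA _ _ _ rfl
  have h₂ : InPhase x G H c d K B t s₂ L :=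
    h₁.congr (fun i hi => eval_v_of_not_writesV _ _ _ (by revert i; decide)) ha₂
  have hu₂ : s₂.v vU = q.1 := by rw [hs₂, eval_v_of_not_writesV _ _ _ rfl, hu₁]
  have hv₂ : s₂.v vV = q.2 := by rw [hs₂, eval_v_of_not_writesV _ _ _ rfl, hv₁]
  have hev : tryAdd.eval x s = (ite (var vBad) (.seq (put aFst (var vLen) (var vU)) <|
    .seq (put aSnd (var vLen) (var vV)) (set vLen (var vLen + lit 1))) skip).eval x s₂ := rfl
  rw [hev, Greedy.tryAdd, Cmd.eval, Expr.eval]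
  by_cases hcond : Greedy.cls c d q = t ∧ ∀ p ∈ L, Greedy.Compat G H p q
  · rw [if_pos (hbad.2 hcond), if_pos hcond]
    simp only [Cmd.eval, Expr.eval, St.setA_v, hu₂, hv₂, h₂.holds.len]
    refine ⟨h₂.ctx.congr (fun i hi => ?_) (fun k hk => ?_), ?_, ?_, ⟨?_, fun k hk => ?_,
      fun k hk => ?_⟩, ?_⟩
    · rw [St.setV_v_of_ne _ _ (by revert i; decide)]; rfl
    · rw [St.setV_a, St.setA_a_of_ne _ _ _ (by revert k; decide),
        St.setA_a_of_ne _ _ _ (by revert k; decide)]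
    · rw [St.setV_v_of_ne _ _ (by decide)]; exact h₂.i
    · rw [St.setV_v_of_ne _ _ (by decide)]; exact h₂.j
    · simp
    · rw [St.setV_a, St.setA_a_of_ne _ _ _ (by decide), St.setA_a]
      rw [List.length_append, List.length_singleton] at hk
      rw [List.getElem_append]
      split_ifs with e1 e2 e2
      · omega
      · simp
      · exact h₂.holds.fst k e2
      · exact absurd ⟨rfl, by omega⟩ e1
    · rw [St.setV_a, St.setA_a, St.setA_a_of_ne _ _ _ (by decide)]
      rw [List.length_append, List.length_singleton] at hk
      rw [List.getElem_append]
      split_ifs with e1 e2 e2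
      · omega
      · simp
      · exact h₂.holds.snd k e2
      · exact absurd ⟨rfl, by omega⟩ e1
    · exact List.pairwise_append.2 ⟨h.valid, List.pairwise_singleton _ _, by simpa using hcond.2⟩
  · rw [if_neg (mt hbad.1 hcond), if_neg hcond]
    exact h₂

theorem eval_phase {t : ℕ × ℕ} {s : St} {L : List (Fin n × Fin m)}
    (h : InPhase x G H c d K B t s L) :
    InPhase x G H c d K B t (phase.eval x s)
      (Greedy.phase G H c d (List.finRange n) (List.finRange m) L t) := by
  refine rel_loop x (R := InPhase x G H c d K B t) h.ctx.graph₁.1 h fun s L u h => ?_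
  refine (rel_loop x (R := fun s L => InPhase x G H c d K B t s L ∧ s.v vU = u)
    (f := fun L v => Greedy.tryAdd G H c d t L (u, v)) (s := s.setV vU u)
    (z := vN true) h.ctx.graph₂.1
    ⟨h.setV _ (by decide), by simp⟩ fun s L v h => ⟨?_, ?_⟩).1
  · refine eval_tryAdd (h.1.setV _ (by decide)) (u, v) ?_ (by simp)
    rw [St.setV_v_of_ne _ _ (by decide), h.2]
  · rw [eval_v_of_not_writesV _ _ _ rfl, St.setV_v_of_ne _ _ (by decide), h.2]

variable (G H c d K) in
/-- Split two digits off the guess and run the phase that they prescribe. -/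
noncomputable def guessStep (a : ℕ × List (Fin n × Fin m)) : ℕ × List (Fin n × Fin m) :=
  (a.1 / K / K, Greedy.phase G H c d (List.finRange n) (List.finRange m) a.2
    (a.1 % K, a.1 / K % K))

/-- The invariant of the sequence of phases. -/
structure InPhases (x : List ℕ) (G : SimpleGraph (Fin n)) (H : SimpleGraph (Fin m))
    (c : Fin n → ℕ) (d : Fin m → ℕ) (K B : ℕ) (s : St) (a : ℕ × List (Fin n × Fin m)) :
    Prop where
  ctx : Ctx x G H c d K B s
  guess : s.v vGuess = a.1
  le : a.1 ≤ B
  holds : Holds a.2 s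
  valid : Greedy.Valid G H a.2

theorem InPhases.congr {s s' : St} {a : ℕ × List (Fin n × Fin m)}
    (h : InPhases x G H c d K B s a)
    (hv : ∀ i ∈ [1, 2, 6, 7, 14, 18], s'.v i = s.v i) (ha : s'.a = s.a) :
    InPhases x G H c d K B s' a where
  ctx := h.ctx.congr (fun i hi => hv i (by revert i; decide)) fun k _ => by rw [ha]
  guess := by rw [hv _ (by decide), h.guess]
  le := h.le
  holds := h.holds.congr (hv _ (by decide)) (by rw [ha]) (by rw [ha])
  valid := h.valid

theorem InPhases.setV {s : St} {a : ℕ × List (Fin n × Fin m)} (h : InPhases x G H c d K B s a)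
    {i : ℕ} (k : ℕ) (hi : i ∉ [1, 2, 6, 7, 14, 18]) : InPhases x G H c d K B (s.setV i k) a :=
  h.congr (fun _ hj => St.setV_v_of_ne _ _ fun he => hi (he ▸ hj)) rfl

theorem eval_guessStep {s : St} {a : ℕ × List (Fin n × Fin m)} (hK : 0 < K)
    (h : InPhases x G H c d K B s a) :
    InPhases x G H c d K B ((Cmd.seq (digit vI) (.seq (digit vJ) phase)).eval x s)
      (guessStep G H c d K a) := by
  have hctx := h.ctx
  obtain ⟨hg₁, hi₁⟩ := eval_digit x vI s (by decide) (by rw [hctx.base]; exact hK) (by decide)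
    (by rw [h.guess, hctx.bound]; exact h.le)
  set s₁ := (digit vI).eval x s with hs₁
  have hctx₁ : Ctx x G H c d K B s₁ := hctx.eval _ (by decide) (by decide)
  rw [hctx.base, h.guess] at hg₁ hi₁
  have hle₁ : a.1 / K ≤ B := (Nat.div_le_self _ _).trans h.le
  obtain ⟨hg₂, hj₂⟩ := eval_digit x vJ s₁ (by decide) (by rw [hctx₁.base]; exact hK) (by decide)
    (by rw [hg₁, hctx₁.bound]; exact hle₁)
  set s₂ := (digit vJ).eval x s₁ with hs₂
  have hctx₂ : Ctx x G H c d K B s₂ := hctx₁.eval _ (by decide) (by decide)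
  rw [hctx₁.base, hg₁] at hg₂ hj₂
  have hi₂ : s₂.v vI = a.1 % K := by rw [hs₂, eval_v_of_not_writesV _ _ _ rfl, hi₁]
  have hh₂ : Holds a.2 s₂ := by
    refine h.holds.congr ?_ ?_ ?_
    · rw [hs₂, eval_v_of_not_writesV _ _ _ rfl, hs₁, eval_v_of_not_writesV _ _ _ rfl]
    · rw [hs₂, eval_a_of_not_writesA _ _ _ rfl, hs₁, eval_a_of_not_writesA _ _ _ rfl]
    · rw [hs₂, eval_a_of_not_writesA _ _ _ rfl, hs₁, eval_a_of_not_writesA _ _ _ rfl]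
  have hph := eval_phase (t := (a.1 % K, a.1 / K % K)) ⟨hctx₂, hi₂, hj₂, hh₂, h.valid⟩
  rw [Cmd.eval, Cmd.eval, ← hs₁, ← hs₂]
  exact ⟨hph.ctx, (eval_v_of_not_writesV _ _ _ rfl).trans hg₂, (Nat.div_le_self _ _).trans hle₁,
    hph.holds, hph.valid⟩

theorem eval_phases {s : St} {a : ℕ × List (Fin n × Fin m)} (h : InPhases x G H c d K B s a) :
    InPhases x G H c d K B (phases.eval x s) ((guessStep G H c d K)^[K * K] a) := by
  -- The K² iterations appear as two nested loops of K rounds. A loop index witnesses 0 < K, which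
  -- the division needs; for K = 0 no digit is ever split off.
  have hit : ((guessStep G H c d K)^[K * K] a) = (List.finRange K).foldl
      (fun a _ => (List.finRange K).foldl (fun a _ => guessStep G H c d K a) a) a := by
    simp only [List.foldl_const, List.length_finRange, Function.iterate_mul]
  rw [hit]
  refine rel_loop x (R := InPhases x G H c d K B) h.ctx.base h fun s a u h => ?_
  refine rel_loop x (R := InPhases x G H c d K B) h.ctx.base (h.setV _ (by decide))
    fun s a v h => eval_guessStep u.pos (h.setV _ (by decide))

/-- The search succeeds if and only if some guess does. -/
theorem eval_search {s : St} (h : Ctx x G H c d K B s) (h0 : s.v vRes = 0) :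
    ((∃ g < B, x.getD 2 0 ≤ ((guessStep G H c d K)^[K * K] (g, [])).2.length) →
      (search.eval x s).v vRes = 1) ∧
    ((¬ ∃ g < B, x.getD 2 0 ≤ ((guessStep G H c d K)^[K * K] (g, [])).2.length) →
      (search.eval x s).v vRes = 0) := by
  have hinv := inv_loop x (i := vG) (z := vBound) (s := s)
    (c := .seq (set vGuess (var vG)) <| .seq (set vLen (lit 0)) <| .seq phases <|
      ite (inp (lit 2) - var vLen) (set vRes (lit 1)) skip)
    (R := fun l s' => Ctx x G H c d K B s' ∧
      ((∃ g < l, x.getD 2 0 ≤ ((guessStep G H c d K)^[K * K] (g, [])).2.length) → s'.v vRes = 1) ∧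
      ((¬ ∃ g < l, x.getD 2 0 ≤ ((guessStep G H c d K)^[K * K] (g, [])).2.length) →
        s'.v vRes = 0))
    ⟨h, by simp, fun _ => h0⟩ ?_
  · rw [h.bound] at hinv
    exact hinv.2
  · rintro l s' hl ⟨h1, h2, h3⟩
    rw [h.bound] at hl
    set s₁ := ((s'.setV vG l).setV vGuess l).setV vLen 0 with hs₁
    have hv₁ : ∀ i, i ≠ vG → i ≠ vGuess → i ≠ vLen → s₁.v i = s'.v i := fun i a b c => by
      rw [hs₁, St.setV_v_of_ne _ _ c, St.setV_v_of_ne _ _ b, St.setV_v_of_ne _ _ a]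
    have hin : InPhases x G H c d K B s₁ (l, []) :=
      ⟨h1.congr (fun i hi => hv₁ i (by revert i; decide) (by revert i; decide)
        (by revert i; decide)) fun _ _ => rfl, by simp [hs₁, St.setV_v], hl.le,
        ⟨by simp [hs₁], by simp, by simp⟩, List.Pairwise.nil⟩
    have hout := eval_phases hin
    set s₂ := phases.eval x s₁ with hs₂
    have hr₂ : s₂.v vRes = s'.v vRes := by
      rw [hs₂, eval_v_of_not_writesV _ _ _ rfl, hv₁ _ (by decide) (by decide) (by decide)]
    have hev : ((Cmd.seq (set vGuess (var vG)) <| .seq (set vLen (lit 0)) <| .seq phases <|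
      ite (inp (lit 2) - var vLen) (set vRes (lit 1)) skip)).eval x (s'.setV vG l) =
      (ite (inp (lit 2) - var vLen) (set vRes (lit 1)) skip).eval x s₂ := by
      simp only [Cmd.eval, Expr.eval, St.setV_v_self, hs₂, hs₁]
    rw [hev, Cmd.eval, eval_sub, Expr.eval, Expr.eval, Expr.eval, hout.holds.len]
    simp only [Nat.sub_eq_zero_iff_le]
    split_ifs with hacc
    · refine ⟨hout.ctx.eval _ (by decide) (by decide), fun _ => by
        rw [Cmd.eval, St.setV_v_self, Expr.eval], fun hne => absurd ⟨l, Nat.lt_succ_self l, hacc⟩ hne⟩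
    · rw [Cmd.eval]
      refine ⟨hout.ctx, ?_, fun hne => ?_⟩
      · rintro ⟨g, hg, hgl⟩
        rw [hr₂]
        rcases Nat.lt_succ_iff_lt_or_eq.1 hg with hg | rfl
        · exact h2 ⟨g, hg, hgl⟩
        · exact absurd hgl hacc
      · rw [hr₂]
        exact h3 fun ⟨g, hg, hgl⟩ => hne ⟨g, by omega, hgl⟩

end Greedy

end MCIS

namespace MCIS

open LoopLang LoopLang.Expr LoopLang.Cmd

/-! ### Guesses -/

section Guesses

variable {n m : ℕ} {G : SimpleGraph (Fin n)} {H : SimpleGraph (Fin m)} {c : Fin n → ℕ}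
  {d : Fin m → ℕ} {K : ℕ}

theorem exists_guess (l : List (ℕ × ℕ)) (hl : ∀ t ∈ l, t.1 < K ∧ t.2 < K) :
    ∃ g < K ^ (2 * l.length), ∀ L, ((guessStep G H c d K)^[l.length] (g, L)).2 =
      l.foldl (Greedy.phase G H c d (List.finRange n) (List.finRange m)) L := by
  induction l with
  | nil => exact ⟨0, by simp⟩
  | cons t l ih =>
    obtain ⟨g, hg, hgL⟩ := ih fun t ht => hl t (List.mem_cons_of_mem _ ht)
    obtain ⟨h1, h2⟩ := hl t (by simp)
    have hK : 0 < K := by omega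
    -- The first cell occupies the two lowest digits, which `guessStep` splits off first.
    refine ⟨t.1 + K * (t.2 + K * g), ?_, fun L => ?_⟩
    · have h3 : t.2 + K * g + 1 ≤ K * K ^ (2 * l.length) := by
        calc t.2 + K * g + 1 ≤ K * (g + 1) := by rw [mul_add, mul_one]; omega
          _ ≤ _ := Nat.mul_le_mul_left _ hg
      calc t.1 + K * (t.2 + K * g) < K * (t.2 + K * g + 1) := by rw [mul_add K _ 1, mul_one]; omega
        _ ≤ K * (K * K ^ (2 * l.length)) := Nat.mul_le_mul_left _ h3
        _ = K ^ (2 * (t :: l).length) := by rw [List.length_cons]; ring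
    · have e1 : (t.1 + K * (t.2 + K * g)) % K = t.1 := by
        rw [Nat.add_mul_mod_self_left, Nat.mod_eq_of_lt h1]
      have e2 : (t.1 + K * (t.2 + K * g)) / K = t.2 + K * g := by
        rw [Nat.add_mul_div_left _ _ hK, Nat.div_eq_of_lt h1, zero_add]
      have e3 : (t.2 + K * g) % K = t.2 := by
        rw [Nat.add_mul_mod_self_left, Nat.mod_eq_of_lt h2]
      have e4 : (t.2 + K * g) / K = g := by
        rw [Nat.add_mul_div_left _ _ hK, Nat.div_eq_of_lt h2, zero_add]
      rw [List.length_cons, Function.iterate_succ_apply, guessStep, e1, e2, e3, e4, hgL,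
        List.foldl_cons]

/-- The desired sequence may be shorter than K², and the surplus phases are then uncontrolled; they
can only add pairs. -/
theorem length_le_iterate_guessStep (k : ℕ) (a : ℕ × List (Fin n × Fin m)) :
    a.2.length ≤ ((guessStep G H c d K)^[k] a).2.length := by
  induction k with
  | zero => exact le_rfl
  | succ k ih =>
    rw [Function.iterate_succ_apply']
    exact ih.trans (Greedy.length_le_phase G H c d (by simp) (by simp) _ _)

/-- Soundness: every guess, sensible or not, produces an isomorphism between induced subgraphs. -/
theorem valid_iterate_guessStep (k : ℕ) {a : ℕ × List (Fin n × Fin m)}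
    (ha : Greedy.Valid G H a.2) : Greedy.Valid G H ((guessStep G H c d K)^[k] a).2 := by
  induction k with
  | zero => exact ha
  | succ k ih =>
    rw [Function.iterate_succ_apply']
    exact Greedy.valid_phase G H c d (by simp) (by simp) _ ih

/-- Some guess is at least as good as any given common induced subgraph. -/
theorem exists_guess_of_valid (hc : ∀ u u', c u = c u' → G.Twins u u')
    (hd : ∀ v v', d v = d v' → H.Twins v v') {k k' : ℕ} (hk : ∀ u, c u < k)
    (hk' : ∀ v, d v < k') {M : List (Fin n × Fin m)} (hM : Greedy.Valid G H M) :
    ∃ g < (k + k') ^ (2 * ((k + k') * (k + k'))), M.length ≤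
      ((guessStep G H c d (k + k'))^[(k + k') * (k + k')] (g, [])).2.length := by
  obtain ⟨l, h1, h2, h3⟩ := Greedy.exists_phases_of_valid hc hd (us := List.finRange n)
    (vs := List.finRange m) (by simp) (by simp) hk hk' hM
  obtain ⟨g, hg, hgL⟩ := exists_guess (G := G) (H := H) (c := c) (d := d) (K := k + k') l
    fun t ht => ⟨by have := h1 t ht; omega, by have := h1 t ht; omega⟩
  have hlen : l.length ≤ (k + k') * (k + k') :=
    h2.trans (Nat.mul_le_mul (Nat.le_add_right _ _) (Nat.le_add_left _ _))
  refine ⟨g, hg.trans_le ?_, ?_⟩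
  · rcases Nat.eq_zero_or_pos (k + k') with h0 | h0
    · rw [h0] at hlen ⊢
      rw [Nat.le_zero.1 hlen]
    · exact Nat.pow_le_pow_right h0 (by omega)
  · rw [← Nat.sub_add_cancel hlen, Function.iterate_add_apply]
    refine le_trans ?_ (length_le_iterate_guessStep _ _)
    rw [hgL]
    exact h3

end Guesses

/-! ### Instances -/

theorem length_adjBits {n : ℕ} (G : SimpleGraph (Fin n)) : (adjBits G).length = n * n := by
  simp [adjBits]

theorem mul_add_lt {n : ℕ} (u w : Fin n) : n * (u : ℕ) + w < n * n :=
  calc n * (u : ℕ) + w < n * u + n := Nat.add_lt_add_left w.2 _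
    _ = n * (u + 1) := by ring
    _ ≤ n * n := Nat.mul_le_mul_left _ u.2

open Classical in
theorem getElem?_adjBits {n : ℕ} (G : SimpleGraph (Fin n)) (u w : Fin n) :
    (adjBits G)[n * u + w]? = some (if G.Adj u w then 1 else 0) := by
  have hn : 0 < n := u.pos
  have h := mul_add_lt u w
  have h1 : Fin.divNat (⟨n * u + w, h⟩ : Fin (n * n)) = u := by
    ext
    simp [Fin.divNat, Nat.mul_add_div hn, Nat.div_eq_of_lt w.2]
  have h2 : Fin.modNat (⟨n * u + w, h⟩ : Fin (n * n)) = w := by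
    ext
    simp [Fin.modNat, Nat.mod_eq_of_lt w.2]
  rw [adjBits, List.getElem?_ofFn, dif_pos h, h1, h2]

theorem getD_encode₁ (i : MCISInstance) (u w : Fin i.n₁) :
    (i.encode.getD (3 + i.n₁ * u + w) 0 = 1 ∧ i.G₁.Adj u w) ∨
      (i.encode.getD (3 + i.n₁ * u + w) 0 = 0 ∧ ¬ i.G₁.Adj u w) := by
  classical
  have h : i.encode[3 + i.n₁ * u + w]? = some (if i.G₁.Adj u w then 1 else 0) := by
    rw [MCISInstance.encode, List.append_assoc, List.getElem?_append_right (by simp; omega),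
      List.getElem?_append_left (by
        rw [length_adjBits]; have := mul_add_lt u w; simp; omega), ← getElem?_adjBits]
    congr 1; simp; omega
  rw [List.getD_eq_getElem?_getD, h]
  by_cases ha : i.G₁.Adj u w <;> simp [ha]

theorem getD_encode₂ (i : MCISInstance) (u w : Fin i.n₂) :
    (i.encode.getD (3 + i.n₁ * i.n₁ + i.n₂ * u + w) 0 = 1 ∧ i.G₂.Adj u w) ∨
      (i.encode.getD (3 + i.n₁ * i.n₁ + i.n₂ * u + w) 0 = 0 ∧ ¬ i.G₂.Adj u w) := by
  classical
  have h : i.encode[3 + i.n₁ * i.n₁ + i.n₂ * u + w]? = some (if i.G₂.Adj u w then 1 else 0) := by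
    rw [MCISInstance.encode, List.getElem?_append_right (by simp [length_adjBits]; omega),
      ← getElem?_adjBits]
    congr 1; simp [length_adjBits]; omega
  rw [List.getD_eq_getElem?_getD, h]
  by_cases ha : i.G₂.Adj u w <;> simp [ha]

theorem length_le_inputSize (x : List ℕ) : x.length ≤ RAM.inputSize x := by
  have := List.length_le_sum_of_one_le (x.map fun a => Nat.size a + 1) (by simp)
  simpa only [RAM.inputSize, List.length_map] using this

/-- Each adjacency matrix contributes n² ≥ n entries, so loops over the vertices are bounded by the
input size; the header makes that size positive. -/
theorem le_inputSize (i : MCISInstance) :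
    1 ≤ RAM.inputSize i.encode ∧ i.n₁ ≤ RAM.inputSize i.encode ∧
      i.n₂ ≤ RAM.inputSize i.encode := by
  have h := length_le_inputSize i.encode
  simp only [MCISInstance.encode, List.length_append, length_adjBits, List.length_cons,
    List.length_nil] at h ⊢
  have h1 := Nat.le_mul_self i.n₁
  have h2 := Nat.le_mul_self i.n₂
  omega

/-- Two embeddings of one graph list the pairs of images of its vertices. Conversely, pulling `G₁`
back along the first coordinates of a valid list gives a graph on the positions, and compatibility
says that the second coordinates embed it into `G₂`. -/
theorem isYes_iff (i : MCISInstance) :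
    i.IsYes ↔ ∃ L, Greedy.Valid i.G₁ i.G₂ L ∧ i.h ≤ L.length := by
  constructor
  · rintro ⟨k, F, hk, ⟨φ⟩, ⟨ψ⟩⟩
    refine ⟨List.ofFn fun t => (φ t, ψ t), List.pairwise_ofFn.2 fun s t hst => ?_, by simpa⟩
    exact ⟨φ.injective.ne hst.ne, ψ.injective.ne hst.ne, φ.map_adj_iff.trans ψ.map_adj_iff.symm⟩
  · rintro ⟨L, hL, hlen⟩
    have hcompat : ∀ s t : Fin L.length, s ≠ t → Greedy.Compat i.G₁ i.G₂ (L.get s) (L.get t) := by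
      intro s t hst
      rcases lt_or_gt_of_ne hst with h | h
      · exact List.pairwise_iff_get.1 hL s t h
      · exact (List.pairwise_iff_get.1 hL t s h).symm
    have inj₁ : Function.Injective fun t => (L.get t).1 := fun s t hst => by
      by_contra hne
      exact (hcompat s t hne).1 hst
    have inj₂ : Function.Injective fun t => (L.get t).2 := fun s t hst => by
      by_contra hne
      exact (hcompat s t hne).2.1 hst
    refine ⟨L.length, i.G₁.comap fun t => (L.get t).1, hlen, ⟨⟨⟨_, inj₁⟩, Iff.rfl⟩⟩,
      ⟨⟨⟨_, inj₂⟩, fun {s t} => ?_⟩⟩⟩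
    by_cases hst : s = t
    · subst hst; simp
    · exact (hcompat s t hst).2.2.symm

/-! ### The program decides the problem -/

/-- The state before the search. -/
theorem eval_before_search (i : MCISInstance) {s₁ s₂ s₃ s₄ : St}
    (h₁ : readSizes.eval i.encode start = s₁) (h₂ : prepare.eval i.encode s₁ = s₂)
    (h₃ : setBase.eval i.encode s₂ = s₃) (h₄ : powers.eval i.encode s₃ = s₄) :
    s₁.v (vN false) = i.n₁ ∧ s₁.v (vN true) = i.n₂ ∧
    ∃ (k k' : ℕ) (c : Fin i.n₁ → ℕ) (d : Fin i.n₂ → ℕ), k ≤ i.G₁.nd ∧ k' ≤ i.G₂.nd ∧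
      (∀ u, c u < k) ∧ (∀ v, d v < k') ∧ (∀ u u', c u = c u' → i.G₁.Twins u u') ∧
      (∀ v v', d v = d v' → i.G₂.Twins v v') ∧ s₃.v vBase = k + k' ∧ s₄.v vRes = 0 ∧
      Ctx i.encode i.G₁ i.G₂ c d (k + k') ((k + k') ^ (2 * ((k + k') * (k + k')))) s₄ := by
  have hn₁ : s₁.v (vN false) = i.n₁ := by rw [← h₁]; rfl
  have hm₁ : s₁.v (vN true) = i.n₂ := by rw [← h₁]; rfl
  have hr₁ : s₁.v vRow = 3 := by rw [← h₁]; rfl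
  have hz₁ : ∀ j ∈ [vRes, vNum false, vNum true], s₁.v j = 0 := by
    rw [← h₁]
    simp only [List.forall_mem_cons]
    exact ⟨rfl, rfl, rfl, by simp⟩
  refine ⟨hn₁, hm₁, ?_⟩
  generalize hx : i.encode = x at *
  obtain ⟨hra, hrow₁⟩ := eval_rows x false s₁ hn₁ hr₁
  generalize hsa : (rows false).eval x s₁ = sa at *
  have hma : sa.v (vN true) = i.n₂ := by rw [← hsa, eval_v_of_not_writesV _ _ _ rfl, hm₁]
  have hGa : HasGraph x false i.G₁ sa := by
    refine ⟨by rw [← hsa, eval_v_of_not_writesV _ _ _ rfl, hn₁], fun u w => ?_⟩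
    rw [hrow₁ u u.2]
    rw [← hx]
    exact getD_encode₁ i u w
  obtain ⟨-, hrow₂⟩ := eval_rows x true sa hma hra
  generalize hsb : (rows true).eval x sa = sb at *
  have hGb : HasGraph x false i.G₁ sb := hsb ▸ hGa.eval _ rfl rfl
  have hHb : HasGraph x true i.G₂ sb := by
    refine ⟨by rw [← hsb, eval_v_of_not_writesV _ _ _ rfl, hma], fun u w => ?_⟩
    rw [hrow₂ u u.2]
    rw [← hx]
    exact getD_encode₂ i u w
  have hzb : ∀ j ∈ [vRes, vNum false, vNum true], sb.v j = 0 := fun j hj => by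
    rw [← hsb, eval_v_of_not_writesV _ _ _ (by revert j; decide), ← hsa,
      eval_v_of_not_writesV _ _ _ (by revert j; decide), hz₁ j hj]
  have hCc := eval_classify hGb (hzb _ (by decide))
  generalize hsc : (classify false).eval x sb = sc at *
  have hkc' : sc.v (vNum true) = 0 := by rw [← hsc, eval_v_of_not_writesV _ _ _ rfl, hzb _ (by decide)]
  have hrc : sc.v vRes = 0 := by rw [← hsc, eval_v_of_not_writesV _ _ _ rfl, hzb _ (by decide)]
  have hHc : HasGraph x true i.G₂ sc := hsc ▸ hHb.eval (classify false) rfl rfl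
  have hC₂ := eval_classify hHc hkc'
  have hs₂ : s₂ = (classify true).eval x sc := by rw [← h₂, ← hsc, ← hsb, ← hsa]; rfl
  rw [← hs₂] at hC₂
  have hr₂ : s₂.v vRes = 0 := by rw [hs₂, eval_v_of_not_writesV _ _ _ rfl, hrc]
  have hk₂ : s₂.v (vNum false) = sc.v (vNum false) := by
    rw [hs₂, eval_v_of_not_writesV _ _ _ rfl]
  have hc₂ : s₂.a (aCls false) = sc.a (aCls false) := by
    rw [hs₂, eval_a_of_not_writesA _ _ _ rfl]
  have hG₂ : HasGraph x false i.G₁ s₂ := hs₂ ▸ hCc.graph.eval _ rfl rfl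
  have hbase : s₃.v vBase = sc.v (vNum false) + s₂.v (vNum true) := by rw [← hk₂, ← h₃]; rfl
  have hone : s₃.v vBound = 1 := by rw [← h₃]; rfl
  have hbound := eval_powers x s₃ hone
  rw [hbase, h₄] at hbound
  have hv₄ : ∀ j, powers.WritesV j = false → s₄.v j = s₃.v j := fun j hj => by
    rw [← h₄, eval_v_of_not_writesV x powers s₃ hj]
  have hv₃ : ∀ j, setBase.WritesV j = false → s₃.v j = s₂.v j := fun j hj => by
    rw [← h₃, eval_v_of_not_writesV x setBase s₂ hj]
  have ha : ∀ k, s₄.a k = s₂.a k := fun k => by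
    rw [← h₄, eval_a_of_not_writesA x powers s₃ rfl, ← h₃, eval_a_of_not_writesA x setBase s₂ rfl]
  refine ⟨sc.v (vNum false), s₂.v (vNum true), fun u => sc.a (aCls false) u,
    fun v => s₂.a (aCls true) v, hCc.num_le_nd, hC₂.num_le_nd, fun u => hCc.lt u u.2,
    fun v => hC₂.lt v v.2, fun u u' h => (hCc.iff u u' u.2 u'.2).1 h,
    fun v v' h => (hC₂.iff v v' v.2 v'.2).1 h, hbase, ?_, ?_⟩
  · rw [hv₄ _ rfl, hv₃ _ rfl, hr₂]
  · exact
      { graph₁ := hG₂.congr (by rw [hv₄ _ rfl, hv₃ _ rfl]) (ha _)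
        graph₂ := hC₂.graph.congr (by rw [hv₄ _ rfl, hv₃ _ rfl]) (ha _)
        cls₁ := fun u => by rw [ha, hc₂]
        cls₂ := fun v => by rw [ha]
        base := by rw [hv₄ _ rfl, hbase]
        bound := hbound }

/-- Both directions of the greedy analysis meet here: `exists_guess_of_valid` for completeness,
`valid_iterate_guessStep` for soundness. -/
theorem eval_program (i : MCISInstance) :
    (i.IsYes → (program.eval i.encode start).v 0 = 1) ∧
      (¬ i.IsYes → (program.eval i.encode start).v 0 = 0) := by
  rw [program, Cmd.eval, Cmd.eval, Cmd.eval, Cmd.eval]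
  generalize h₁ : readSizes.eval i.encode start = s₁
  generalize h₂ : prepare.eval i.encode s₁ = s₂
  generalize h₃ : setBase.eval i.encode s₂ = s₃
  generalize h₄ : powers.eval i.encode s₃ = s₄
  obtain ⟨-, -, k, k', c, d, -, -, hk, hk', hc, hd, -, hres, hctx⟩ :=
    eval_before_search i h₁ h₂ h₃ h₄
  have h := eval_search hctx hres
  have hh : i.encode.getD 2 0 = i.h := rfl
  rw [hh] at h
  have hiff : i.IsYes ↔ ∃ g < (k + k') ^ (2 * ((k + k') * (k + k'))), i.h ≤
      ((guessStep i.G₁ i.G₂ c d (k + k'))^[(k + k') * (k + k')] (g, [])).2.length := by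
    rw [isYes_iff]
    constructor
    · rintro ⟨L, hL, hlen⟩
      obtain ⟨g, hg, hle⟩ := exists_guess_of_valid hc hd hk hk' hL
      exact ⟨g, hg, hlen.trans hle⟩
    · rintro ⟨g, -, hle⟩
      exact ⟨_, valid_iterate_guessStep _ (a := (g, [])) List.Pairwise.nil, hle⟩
  rw [← hiff] at h
  exact h

/-- The program is cut into five parts because loop bounds of a later part are computed by earlier
ones; within each part its bounds are constant, so `cost_le_time` applies with a common M. -/
theorem cost_program_le (i : MCISInstance) :
    program.cost i.encode start ≤ program.time (RAM.inputSize i.encode +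
      ((i.G₁.nd + i.G₂.nd) + (i.G₁.nd + i.G₂.nd + 1) ^
        (2 * ((i.G₁.nd + i.G₂.nd) * (i.G₁.nd + i.G₂.nd))))) := by
  obtain ⟨-, hN₁, hN₂⟩ := le_inputSize i
  set N := RAM.inputSize i.encode with hN
  set κ := i.G₁.nd + i.G₂.nd with hκ
  set M := N + (κ + (κ + 1) ^ (2 * (κ * κ))) with hM
  rw [program, Cmd.cost, Cmd.cost, Cmd.cost, Cmd.cost]
  generalize h₁ : readSizes.eval i.encode start = s₁
  generalize h₂ : prepare.eval i.encode s₁ = s₂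
  generalize h₃ : setBase.eval i.encode s₂ = s₃
  generalize h₄ : powers.eval i.encode s₃ = s₄
  obtain ⟨hn₁, hm₁, k, k', c, d, hk, hk', -, -, -, -, hbase, -, hctx⟩ :=
    eval_before_search i h₁ h₂ h₃ h₄
  generalize i.encode = x at *
  have hK : k + k' ≤ κ := add_le_add hk hk'
  -- The base is raised to κ + 1 so that it is positive and the power is monotone in the exponent
  -- even if κ = 0.
  have hB : (k + k') ^ (2 * ((k + k') * (k + k'))) ≤ (κ + 1) ^ (2 * (κ * κ)) :=
    (Nat.pow_le_pow_left (hK.trans (Nat.le_succ κ)) _).trans (Nat.pow_le_pow_right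
      (Nat.succ_pos κ) (Nat.mul_le_mul_left _ (Nat.mul_le_mul hK hK)))
  have h1 : readSizes.cost x start ≤ readSizes.time M :=
    cost_le_time x (Z := []) _ _ rfl (by simp) (by simp)
  have h2 : prepare.cost x s₁ ≤ prepare.time M := by
    refine cost_le_time x (Z := [1, 2]) _ _ rfl (by decide) ?_
    simp only [List.forall_mem_cons]
    exact ⟨by rw [show s₁.v 1 = i.n₁ from hn₁]; omega,
      by rw [show s₁.v 2 = i.n₂ from hm₁]; omega, by simp⟩
  have h3 : setBase.cost x s₂ ≤ setBase.time M :=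
    cost_le_time x (Z := []) _ _ rfl (by simp) (by simp)
  have h4 : powers.cost x s₃ ≤ powers.time M := by
    refine cost_le_time x (Z := [6]) _ _ rfl (by decide) ?_
    simp only [List.forall_mem_cons]
    exact ⟨by rw [show s₃.v 6 = k + k' from hbase]; omega, by simp⟩
  have h5 : search.cost x s₄ ≤ search.time M := by
    refine cost_le_time x (Z := [1, 2, 6, 7]) _ _ rfl (by decide) ?_
    simp only [List.forall_mem_cons]
    refine ⟨?_, ?_, ?_, ?_, by simp⟩
    · rw [show s₄.v 1 = i.n₁ from hctx.graph₁.1]; omega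
    · rw [show s₄.v 2 = i.n₂ from hctx.graph₂.1]; omega
    · rw [show s₄.v 6 = k + k' from hctx.base]; omega
    · rw [show s₄.v 7 = _ from hctx.bound]; omega
  exact add_le_add h1 (add_le_add h2 (add_le_add h3 (add_le_add h4 h5)))

theorem computable_timeFactor (C D : ℕ) :
    Computable fun κ : ℕ => C * (κ + (κ + 1) ^ (2 * (κ * κ)) + 2) ^ D := by
  have hpow : Primrec₂ fun a b : ℕ => a ^ b := Primrec₂.unpaired'.1 Nat.Primrec.pow
  have hsq : Primrec fun κ : ℕ => 2 * (κ * κ) :=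
    Primrec.nat_mul.comp (Primrec.const 2) (Primrec.nat_mul.comp Primrec.id Primrec.id)
  exact (Primrec.nat_mul.comp (Primrec.const C) (hpow.comp (Primrec.nat_add.comp
    (Primrec.nat_add.comp Primrec.id (hpow.comp Primrec.succ hsq)) (Primrec.const 2))
    (Primrec.const D))).to_comp

end MCIS

theorem mainTheorem4 :
    IsFPT MCISInstance.encode MCISInstance.IsYes (fun i => i.G₁.nd + i.G₂.nd) := by
  obtain ⟨C, D, hCD⟩ := MCIS.program.exists_time_le
  refine ⟨MCIS.program.compile 0 0, _, D, MCIS.computable_timeFactor C D, fun i => ?_⟩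
  have hcost : MCIS.program.cost i.encode LoopLang.start ≤
      C * ((i.G₁.nd + i.G₂.nd) + (i.G₁.nd + i.G₂.nd + 1) ^
        (2 * ((i.G₁.nd + i.G₂.nd) * (i.G₁.nd + i.G₂.nd))) + 2) ^ D *
        RAM.inputSize i.encode ^ D := by
    refine (MCIS.cost_program_le i).trans ((hCD _).trans ?_)
    rw [mul_assoc, ← mul_pow]
    refine Nat.mul_le_mul_left _ (Nat.pow_le_pow_left ?_ _)
    have hN := (MCIS.le_inputSize i).1
    -- With A for the part that depends on the parameter only, N + A + 1 ≤ (A + 2) * N since N ≥ 1.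
    -- This splits the bound into a factor in κ and a power of the input size.
    generalize (i.G₁.nd + i.G₂.nd) + (i.G₁.nd + i.G₂.nd + 1) ^
        (2 * ((i.G₁.nd + i.G₂.nd) * (i.G₁.nd + i.G₂.nd))) = A
    nlinarith
  have heval := MCIS.eval_program i
  generalize MCIS.program = P at *
  exact ⟨fun h => P.outputsWithin_compile _ hcost (heval.1 h),
    fun h => P.outputsWithin_compile _ hcost (heval.2 h)⟩
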